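/- Let $S\subset\mathbb C$ be the universal covering of the graph $\sigma$ (a circle with a segment attached at one point), realized as $$S=\mathbb R\cup\{z\in\mathbb C:\ \operatorname{Re}z\in\mathbb Z,\ \operatorname{Im}z\in[0,1]\},$$ and for $m\in\mathbb Z$ let $B_m=\{z\in S:\operatorname{Re}z=m\}$ be the branch with base point $m$. A degree $1$ $\sigma$-lifting is a continuous map $F:S\to S$ with $F(z+1)=F(z)+1$ for all $z\in S$. For $z\in S$ put $\rho_F(z)=\lim_{n\to\infty}\frac{\operatorname{Re}(F^n(z))-\operatorname{Re}(z)}{n}$ when the limit exists, and let $\operatorname{Rot}(F)$ and $\operatorname{Rot}_{\mathbb R}(F)$ be the sets of all rotation numbers $\rho_F(z)$ that exist, with $z\in S$ and with $z\in\mathbb R$ respectively. Let $\operatorname{Per}(F)$ be the set of periods (mod 1) of $F$: the set of $n\ge 1$ for which there is $z\in S$ with $F^n(z)\in z+\mathbb Z$ and $F^i(z)\notin z+\mathbb Z$ for $1\le i<n$. Let $\mathbb N=\{1,2,3,\dots\}$. The Sharkovsky ordering on $\mathbb N\cup\{2^\infty\}$ is the total ordering given, in decreasing order, by $3,5,7,\dots$;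 $2\cdot3,2\cdot5,2\cdot7,\dots$; $2^2\cdot3,2^2\cdot5,2^2\cdot 7,\dots$; $\dots$; $2^\infty$; $\dots,2^n,\dots,2^3,2^2,2,1$. For $s\in\mathbb N\cup\{2^\infty\}$ let $\operatorname{Sh}(s)$ be the set of all $k\in\mathbb N$ that are less than or equal to $s$ in this ordering. For $c\le d$ let $M(c,d)=\{n\in\mathbb N: c<k/n<d\text{ for some }k\in\mathbb Z\}$. For $\rho\in\mathbb R$ and $A\subset\mathbb N$ let $\Lambda(\rho,A)=\emptyset$ if $\rho\notin\mathbb Q$, and $\Lambda(\rho,A)=\{nq:q\in A\}$ if $\rho=k/n$ with $k\in\mathbb Z$, $n\in\mathbb N$ coprime. **Corollary.** For all $c,d\in\mathbb R$ with $c\le d$ and all $s_c,s_d\in\mathbb N\cup\{2^\infty\}$, there exists a degree $1$ $\sigma$-lifting $F$ such that $$\operatorname{Rot}_{\mathbb R}(F)=\operatorname{Rot}(F)=[c,d]\quad\text{and}\quad \operatorname{Per}(F)=\Lambda(c,\operatorname{Sh}(s_c))\cup M(c,d)\cup\Lambda(d,\operatorname{Sh}(s_d)).$$ Moreover, $F$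 can be chosen so that it extends a lifting of a degree $1$ circle map and collapses each branch onto the image of its base point, that is, $F(\mathbb R)\subset\mathbb R$ and $F(B_m)=\{F(m)\}$ for every $m\in\mathbb Z$. -/

import Mathlib

namespace SigmaMaps

/-! ## The space `S` and its maps -/

/-- The universal covering `S = ℝ ∪ B` of the graph `σ`, realized in `ℂ`: the real axis together
with the vertical unit segments (the branches) attached at the integers. -/
def coverSet : Set ℂ :=
  {z | z.im = 0} ∪ {z | (∃ m : ℤ, z.re = m) ∧ z.im ∈ Set.Icc (0 : ℝ) 1}

/-- The covering space as a topological space (subspace of `ℂ`). -/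
abbrev Cover : Type := coverSet

theorem add_int_mem_coverSet {z : ℂ} (hz : z ∈ coverSet) (k : ℤ) : z + k ∈ coverSet := by
  rcases hz with h | ⟨⟨m, hm⟩, h⟩
  · left
    have h' : z.im = 0 := h
    simp [h']
  · right
    refine ⟨⟨m + k, ?_⟩, ?_⟩
    · simp [hm]
    · simpa using h

theorem int_mem_coverSet (m : ℤ) : (m : ℂ) ∈ coverSet := by
  left
  simp

/-- The deck transformation `z ↦ z + k` of `S`. -/
def deck (k : ℤ) (z : Cover) : Cover := ⟨(z : ℂ) + k, add_int_mem_coverSet z.2 k⟩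

/-- The real line inside `S`. -/
def realLine : Set Cover := {z | (z : ℂ).im = 0}

/-- The branch `B_m` of `S`, namely `S ∩ Re⁻¹(m)`. -/
def branch (m : ℤ) : Set Cover := {z | (z : ℂ).re = m}

/-- The base point `m` of the branch `B_m`. -/
def basePoint (m : ℤ) : Cover := ⟨(m : ℂ), int_mem_coverSet m⟩

/-- The class of continuous maps `F : S → S` of degree `d`, i.e. `F (z + 1) = F z + d`. -/
def Lift (d : ℤ) : Set (Cover → Cover) :=
  {F | Continuous F ∧ ∀ z, F (deck 1 z) = deck d (F z)}

/-! ## Rotation numbers -/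

/-- The rotation number of `z` under `F` exists and equals `ρ`. -/
def HasRotationNumber (F : Cover → Cover) (z : Cover) (ρ : ℝ) : Prop :=
  Filter.Tendsto (fun n : ℕ => ((F^[n] z : ℂ).re - (z : ℂ).re) / (n : ℝ))
    Filter.atTop (nhds ρ)

/-- The rotation set `Rot(F)`: all rotation numbers of points of `S`. -/
def Rot (F : Cover → Cover) : Set ℝ := {ρ | ∃ z, HasRotationNumber F z ρ}

/-- The rotation set `Rot_ℝ(F)`: all rotation numbers of points of `ℝ ⊆ S`. -/
def RotReal (F : Cover → Cover) : Set ℝ := {ρ | ∃ z ∈ realLine, HasRotationNumber F z ρ}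

/-! ## Periods modulo one -/

/-- `F^n(z) ∈ z + ℤ`. -/
def ReturnsModOne (F : Cover → Cover) (z : Cover) (n : ℕ) : Prop :=
  ∃ k : ℤ, F^[n] z = deck k z

/-- `z` is periodic (mod 1) for `F` with (least) period `n`. -/
def IsPeriodModOne (F : Cover → Cover) (z : Cover) (n : ℕ+) : Prop :=
  ReturnsModOne F z n ∧ ∀ i : ℕ, 1 ≤ i → i < n → ¬ ReturnsModOne F z i

/-- `Per(F)`: the set of periods of all periodic (mod 1) points of `F`. -/
def Per (F : Cover → Cover) : Set ℕ+ := {n | ∃ z, IsPeriodModOne F z n}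

/-! ## The Sharkovsky ordering -/

/-- The set of positive integers together with the additional symbol `2^∞`. -/
inductive NSh : Type
  | num (n : ℕ+) : NSh
  | twoInf : NSh

/-- The strict Sharkovsky ordering; `ShLT x y` means that `y` is strictly greater than `x`. In
decreasing order: the odd numbers `> 1` in increasing order, then `2` times these, then `2 ^ 2`
times these, ..., then `2^∞`, and finally the powers of `2` in decreasing order. -/
inductive ShLT : NSh → NSh → Prop
  | sameExponent (k m : ℕ+) (a p q : ℕ) (hp : Odd p) (hq : Odd q) (hq1 : 1 < q) (hqp : q < p)
      (hk : (k : ℕ) = 2 ^ a * p) (hm : (m : ℕ) = 2 ^ a * q) : ShLT (.num k) (.num m)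
  | largerExponent (k m : ℕ+) (a b p q : ℕ) (hp : Odd p) (hq : Odd q) (hp1 : 1 < p) (hq1 : 1 < q)
      (hba : b < a) (hk : (k : ℕ) = 2 ^ a * p) (hm : (m : ℕ) = 2 ^ b * q) :
      ShLT (.num k) (.num m)
  | twoInfLT (m : ℕ+) (b q : ℕ) (hq : Odd q) (hq1 : 1 < q) (hm : (m : ℕ) = 2 ^ b * q) :
      ShLT .twoInf (.num m)
  | powLT (k m : ℕ+) (a b q : ℕ) (hq : Odd q) (hq1 : 1 < q)
      (hk : (k : ℕ) = 2 ^ a) (hm : (m : ℕ) = 2 ^ b * q) : ShLT (.num k) (.num m)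
  | powLTTwoInf (k : ℕ+) (a : ℕ) (hk : (k : ℕ) = 2 ^ a) : ShLT (.num k) .twoInf
  | powLTPow (k m : ℕ+) (a b : ℕ) (hab : a < b) (hk : (k : ℕ) = 2 ^ a) (hm : (m : ℕ) = 2 ^ b) :
      ShLT (.num k) (.num m)

/-- The Sharkovsky ordering. -/
def ShLE (x y : NSh) : Prop := x = y ∨ ShLT x y

/-- `Sh(s)`: the positive integers that are less than or equal to `s` in the Sharkovsky
ordering. -/
def Sh (s : NSh) : Set ℕ+ := {k | ShLE (.num k) s}

/-! ## The sets `M(c, d)` and `Λ(ρ, A)` -/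

/-- `M(c, d)`: the positive integers `n` with `c < k / n < d` for some integer `k` (not necessarily
coprime to `n`). -/
def M (c d : ℝ) : Set ℕ+ := {n | ∃ k : ℤ, c < (k : ℝ) / (n : ℝ) ∧ (k : ℝ) / (n : ℝ) < d}

/-- `Λ(ρ, A)`: the set `{n q | q ∈ A}` if `ρ = k / n` in lowest terms, and the empty set if `ρ` is
irrational. -/
def Lam (ρ : ℝ) (A : Set ℕ+) : Set ℕ+ :=
  {m | ∃ (k : ℤ) (n : ℕ+), IsCoprime k (n : ℤ) ∧ ρ = (k : ℝ) / (n : ℝ) ∧ ∃ q ∈ A, m = n * q}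

end SigmaMaps

/-! Collapsing each branch to its base point and then applying a lifting `f` of a degree one circle
map gives a map of `S` whose images lie on the real line. Its rotation numbers and periods modulo
one are therefore those of `f`, and it suffices to find a suitable `f : ℝ → ℝ`.

Whatever lies strictly between two realized rotation numbers `c < d` comes for free. If `c < k / n <
d`, then `g = f^n - k` moves points in both directions past any given point. A pair `b < a`
maximizing the drop `g b - g a` then yields a horseshoe, so `g` has points of every least period
(`IsLift.exists_minimalPeriod`); this gives the periods in `M(c, d)`. The same pair for a high
iterate gives an interval covering itself and its translate by one, and itineraries through its
translates realize every intermediate rotation number (`IsLift.exists_rotNum`).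

It remains to control the two ends, and by the reflection `x ↦ -x` only lower ends need study
(`LowerEnd`). The key is a lifting `L` such that every lifting `F ≥ L` that agrees with `L` on
certain small arcs has lower end `c` with the prescribed periods (`exists_lower`). If `c = k / n`,
then `L` is the rotation by `c` with a small copy of an interval map `g` on one arc. A periodic
orbit of `F` with rotation number `c` either advances by at least `c` at each step, and then its
period is `n`, or it passes through that arc, where `F^n - k` is a copy of `g`
(`lowerEnd_of_rotBump`). If `c` is irrational, `L` is a monotone lifting with an orbit inside the
arcs, which `F` shares; no periods occur at `c` (`lowerEnd_of_stairLift`). For `c < d`, the lower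
lifting for `c` and the reflected one for `-d` live on disjoint families of arcs, and interpolating
between them produces `f` (`exists_lift_of_lt`).

The interval map `g` must have a prescribed initial segment of the Sharkovsky ordering as its set of
periods. Štefan orbits give the odd numbers, period doubling the even ones, and countably many
shrinking copies side by side give arbitrary segments, including the one of `2^∞`
(`exists_map_of_periodSet`). -/

namespace SigmaMaps

open Filter Topology

/-! ### Liftings of circle maps, rotation numbers and periods modulo one -/

/-- Liftings of continuous circle maps of degree one. -/
structure IsLift (f : ℝ → ℝ) : Prop where
  cont : Continuous f
  map_add_one : ∀ x, f (x + 1) = f x + 1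

/-- The rotation number of the point `x` exists and equals `ρ`. -/
def RotNum (f : ℝ → ℝ) (x ρ : ℝ) : Prop :=
  Tendsto (fun n : ℕ => (f^[n] x - x) / (n : ℝ)) atTop (𝓝 ρ)

/-- The `n`-th iterate of `x` differs from `x` by an integer. -/
def Returns (f : ℝ → ℝ) (x : ℝ) (n : ℕ) : Prop := ∃ k : ℤ, f^[n] x = x + k

/-- `n` is the least period modulo one of `x`. -/
def IsPer (f : ℝ → ℝ) (x : ℝ) (n : ℕ+) : Prop :=
  Returns f x n ∧ ∀ i : ℕ, 1 ≤ i → i < n → ¬ Returns f x i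

namespace IsLift

variable {f : ℝ → ℝ} (hf : IsLift f)
include hf

theorem map_add_nat (x : ℝ) (k : ℕ) : f (x + k) = f x + k := by
  induction k with
  | zero => simp
  | succ k ih => rw [Nat.cast_succ, ← add_assoc, hf.map_add_one, ih, add_assoc]

theorem map_add_int (x : ℝ) (k : ℤ) : f (x + k) = f x + k := by
  obtain ⟨n, rfl | rfl⟩ := k.eq_nat_or_neg
  · simpa using hf.map_add_nat x n
  · have := hf.map_add_nat (x - n) n
    rw [sub_add_cancel] at this
    push_cast
    rw [← sub_eq_add_neg]
    linarith

theorem iterate (n : ℕ) : IsLift f^[n] := by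
  refine ⟨hf.cont.iterate n, ?_⟩
  induction n with
  | zero => simp
  | succ n ih =>
    intro x
    simp only [Function.iterate_succ_apply']
    rw [ih, hf.map_add_one]

theorem sub_int (k : ℤ) : IsLift fun x => f x - k :=
  ⟨hf.cont.sub continuous_const, fun x => by simp only [hf.map_add_one]; ring⟩

theorem iterate_add_int (n : ℕ) (x : ℝ) (k : ℤ) : f^[n] (x + k) = f^[n] x + k :=
  (hf.iterate n).map_add_int x k

theorem iterate_mul (n : ℕ) (k : ℤ) (q : ℕ) (x : ℝ) :
    f^[n * q] x = (fun y => f^[n] y - k)^[q] x + (k * q : ℤ) := by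
  induction q with
  | zero => simp
  | succ q ih =>
    rw [Nat.mul_succ, add_comm, Function.iterate_add_apply, ih, hf.iterate_add_int,
      Function.iterate_succ_apply']
    push_cast
    ring

end IsLift

theorem RotNum.of_bounded {f : ℝ → ℝ} {x ρ C : ℝ} (h : ∀ i : ℕ, |f^[i] x - x - i * ρ| ≤ C) :
    RotNum f x ρ := by
  rw [RotNum, tendsto_iff_norm_sub_tendsto_zero]
  have h0 : Tendsto (fun n : ℕ => C / (n : ℝ)) atTop (𝓝 0) :=
    tendsto_const_nhds.div_atTop tendsto_natCast_atTop_atTop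
  refine squeeze_zero' (Eventually.of_forall fun _ => norm_nonneg _) ?_ h0
  filter_upwards [eventually_gt_atTop 0] with n hn
  have hn' : (0 : ℝ) < n := by exact_mod_cast hn
  have : (f^[n] x - x) / n - ρ = (f^[n] x - x - n * ρ) / n := by field_simp
  rw [this, Real.norm_eq_abs, abs_div, abs_of_pos hn']
  exact div_le_div_of_nonneg_right (h n) hn'.le

theorem RotNum.ge_of_le {f : ℝ → ℝ} {x ρ σ C : ℝ} (hρ : RotNum f x ρ)
    (h : ∀ i : ℕ, i * σ - C ≤ f^[i] x - x) : σ ≤ ρ := by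
  have h0 : Tendsto (fun n : ℕ => σ - C / (n : ℝ)) atTop (𝓝 (σ - 0)) :=
    tendsto_const_nhds.sub (tendsto_const_nhds.div_atTop tendsto_natCast_atTop_atTop)
  rw [sub_zero] at h0
  refine le_of_tendsto_of_tendsto h0 hρ ?_
  filter_upwards [eventually_gt_atTop 0] with n hn
  have hn' : (0 : ℝ) < n := by exact_mod_cast hn
  rw [le_div_iff₀ hn']
  have := h n
  have h2 : (σ - C / n) * n = n * σ - C := by field_simp
  linarith

/-- Once the drift `i * (K / N)` is removed, the displacement depends only on `i` modulo `N`, so it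
is bounded. -/
theorem IsLift.rotNum_of_returns {f : ℝ → ℝ} (hf : IsLift f) {x : ℝ} {N : ℕ} (hN : 0 < N) {K : ℤ}
    (h : f^[N] x = x + K) : RotNum f x ((K : ℝ) / N) := by
  have hN' : (0 : ℝ) < N := by exact_mod_cast hN
  have key : ∀ i : ℕ, f^[i] x - x - i * ((K : ℝ) / N)
      = f^[i % N] x - x - (i % N : ℕ) * ((K : ℝ) / N) := by
    intro i
    have h0 := Nat.mod_add_div i N
    set r := i % N
    set e := i / N
    have h1 : (fun y => f^[N] y - K)^[e] x = x :=
      Function.iterate_fixed (f := fun y => f^[N] y - K) (by simp [h]) _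
    have h2 : f^[i] x = f^[r] x + (K * (e : ℕ) : ℤ) := by
      conv_lhs => rw [← h0]
      rw [Function.iterate_add_apply, hf.iterate_mul N K, h1, hf.iterate_add_int]
    have h3 : (i : ℝ) = (r : ℕ) + N * (e : ℕ) := by
      exact_mod_cast h0.symm
    have h4 : (i : ℝ) * (K / N) = (r : ℕ) * ((K : ℝ) / N) + K * (e : ℕ) := by
      rw [h3]; field_simp
    rw [h2, h4]; push_cast; ring
  refine RotNum.of_bounded
    (C := ∑ r ∈ Finset.range N, |f^[r] x - x - r * ((K : ℝ) / N)|) fun i => ?_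
  rw [key]
  exact Finset.single_le_sum (f := fun r : ℕ => |f^[r] x - x - r * ((K : ℝ) / N)|)
    (fun _ _ => abs_nonneg _) (Finset.mem_range.2 (Nat.mod_lt _ hN))

theorem dvd_of_ratio {k : ℤ} {n : ℕ} (hn : 0 < n) (hkn : IsCoprime k (n : ℤ)) {N : ℕ} (hN : 0 < N)
    {K : ℤ} (h : (K : ℝ) / N = k / n) : ∃ q : ℕ, 0 < q ∧ N = n * q ∧ K = k * q := by
  have h1 : (K : ℝ) * n = k * N := by
    have : (n : ℝ) ≠ 0 := by positivity
    have : (N : ℝ) ≠ 0 := by positivity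
    field_simp at h
    linarith
  have h2 : K * n = k * N := by exact_mod_cast h1
  have h3 : (n : ℤ) ∣ N := hkn.symm.dvd_of_dvd_mul_left (Dvd.intro_left K h2)
  obtain ⟨q, rfl⟩ := Int.natCast_dvd_natCast.1 h3
  refine ⟨q, Nat.pos_of_mul_pos_left hN, rfl, ?_⟩
  have h4 : (n : ℤ) ≠ 0 := by exact_mod_cast hn.ne'
  apply mul_right_cancel₀ h4
  rw [h2]; push_cast; ring

/-- At a rational rotation number `k / n`, periods modulo one are `n` times the periods of
`f^n - k`. -/
theorem IsLift.isPer_of_minimalPeriod {f : ℝ → ℝ} (hf : IsLift f) {k : ℤ} {n : ℕ+}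
    (hkn : IsCoprime k (n : ℤ)) {x : ℝ} {q : ℕ+}
    (h : Function.minimalPeriod (fun y => f^[n] y - k) x = q) : IsPer f x (n * q) := by
  have hper : (fun y => f^[(n : ℕ)] y - k)^[(q : ℕ)] x = x := by
    rw [← h]; exact Function.iterate_minimalPeriod
  have hret : f^[(n * q : ℕ+)] x = x + (k * q : ℤ) := by
    rw [PNat.mul_coe, hf.iterate_mul n k, hper]
  refine ⟨⟨_, hret⟩, fun i hi1 hi ⟨K, hK⟩ => ?_⟩
  have h1 := hf.rotNum_of_returns (n * q).pos hret
  have h2 := hf.rotNum_of_returns hi1 hK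
  have h3 := tendsto_nhds_unique h2 h1
  have h4 : ((k * q : ℤ) : ℝ) / ((n * q : ℕ+) : ℕ) = k / (n : ℕ) := by
    have : ((q : ℕ) : ℝ) ≠ 0 := by positivity
    push_cast
    field_simp
  -- A return at time `i` has the same rotation number `k / n`, in lowest terms; hence it is a
  -- return of `f^n - k` at time `r = i / n`.
  obtain ⟨r, hr, rfl, rfl⟩ := dvd_of_ratio n.pos hkn hi1 (h3.trans h4)
  rw [hf.iterate_mul n k] at hK
  have h5 : (fun y => f^[(n : ℕ)] y - k)^[r] x = x := by linarith
  have h6 := Function.IsPeriodicPt.minimalPeriod_le hr h5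
  rw [h] at h6
  rw [PNat.mul_coe] at hi
  exact absurd hi (not_lt.2 (Nat.mul_le_mul_left _ h6))

theorem IsLift.minimalPeriod_of_isPer {f : ℝ → ℝ} (hf : IsLift f) {k : ℤ} {n : ℕ+}
    (hkn : IsCoprime k (n : ℤ)) {x : ℝ} {N : ℕ+} (h : IsPer f x N)
    (hx : RotNum f x ((k : ℝ) / n)) :
    ∃ q : ℕ+, N = n * q ∧ Function.minimalPeriod (fun y => f^[n] y - k) x = q := by
  obtain ⟨⟨K, hK⟩, hmin⟩ := h
  have h1 := tendsto_nhds_unique (hf.rotNum_of_returns N.pos hK) hx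
  obtain ⟨q, hq, hN, rfl⟩ := dvd_of_ratio n.pos hkn N.pos h1
  rw [hN, hf.iterate_mul n k] at hK
  have h5 : Function.IsPeriodicPt (fun y => f^[(n : ℕ)] y - k) q x := by
    change (fun y => f^[(n : ℕ)] y - k)^[q] x = x
    linarith
  refine ⟨⟨q, hq⟩, PNat.eq hN, ?_⟩
  refine le_antisymm (h5.minimalPeriod_le hq) (not_lt.1 fun hlt => ?_)
  have hp := h5.minimalPeriod_pos hq
  refine hmin (n * Function.minimalPeriod (fun y => f^[(n : ℕ)] y - k) x) ?_ ?_
    ⟨k * (Function.minimalPeriod (fun y => f^[(n : ℕ)] y - k) x : ℕ), ?_⟩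
  · exact Nat.mul_pos n.pos hp
  · rw [hN]; exact Nat.mul_lt_mul_of_pos_left hlt n.pos
  · rw [hf.iterate_mul n k, Function.iterate_minimalPeriod]

end SigmaMaps

namespace SigmaMaps

open Filter Topology Set

/-! ## Covering relations -/

/-- Let `a` be the last point of `[p, q]` with value `u`, and `b` the first point after it with
value `v`. By the intermediate value theorem, `g` cannot leave `[u, v]` in between. -/
theorem exists_Icc_of_le {g : ℝ → ℝ} (hg : Continuous g) {p q u v : ℝ} (hpq : p ≤ q) (huv : u ≤ v)
    (hp : g p = u) (hq : g q = v) :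
    ∃ a b, p ≤ a ∧ a ≤ b ∧ b ≤ q ∧ MapsTo g (Icc a b) (Icc u v) ∧ g a = u ∧ g b = v := by
  have c1 : IsCompact (Icc p q ∩ g ⁻¹' {u}) :=
    isCompact_Icc.inter_right (isClosed_singleton.preimage hg)
  have m1 := c1.sSup_mem ⟨p, left_mem_Icc.2 hpq, hp⟩
  set a := sSup (Icc p q ∩ g ⁻¹' {u}) with ha
  obtain ⟨⟨hpa, haq⟩, hga⟩ := m1
  have hga : g a = u := hga
  have c2 : IsCompact (Icc a q ∩ g ⁻¹' {v}) :=
    isCompact_Icc.inter_right (isClosed_singleton.preimage hg)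
  have m2 := c2.sInf_mem ⟨q, right_mem_Icc.2 haq, hq⟩
  set b := sInf (Icc a q ∩ g ⁻¹' {v}) with hb
  obtain ⟨⟨hab, hbq⟩, hgb⟩ := m2
  have hgb : g b = v := hgb
  refine ⟨a, b, hpa, hab, hbq, fun x hx => ⟨?_, ?_⟩, hga, hgb⟩
  · by_contra! hlt
    obtain ⟨y, hy, hgy⟩ := intermediate_value_Icc hx.2 hg.continuousOn
      ⟨hlt.le, by rw [hgb]; exact huv⟩
    have h1 : y ≤ a := le_csSup c1.bddAbove ⟨⟨hpa.trans (hx.1.trans hy.1), hy.2.trans hbq⟩, hgy⟩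
    have h2 : x = a := le_antisymm (hy.1.trans h1) hx.1
    rw [h2, hga] at hlt
    exact lt_irrefl _ hlt
  · by_contra! hlt
    obtain ⟨y, hy, hgy⟩ := intermediate_value_Icc hx.1 hg.continuousOn
      ⟨by rw [hga]; exact huv, hlt.le⟩
    have h1 : b ≤ y := csInf_le c2.bddBelow ⟨⟨hy.1, hy.2.trans (hx.2.trans hbq)⟩, hgy⟩
    have h2 : x = b := le_antisymm hx.2 (h1.trans hy.2)
    rw [h2, hgb] at hlt
    exact lt_irrefl _ hlt

theorem exists_Icc_of_subset_image {g : ℝ → ℝ} (hg : Continuous g) {l r u v : ℝ} (huv : u ≤ v)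
    (h : Icc u v ⊆ g '' Icc l r) :
    ∃ a b, l ≤ a ∧ a ≤ b ∧ b ≤ r ∧ MapsTo g (Icc a b) (Icc u v) ∧
      (g a = u ∧ g b = v ∨ g a = v ∧ g b = u) := by
  obtain ⟨p, hp, hgp⟩ := h (left_mem_Icc.2 huv)
  obtain ⟨q, hq, hgq⟩ := h (right_mem_Icc.2 huv)
  rcases le_total p q with hpq | hqp
  · obtain ⟨a, b, h1, h2, h3, h4, h5, h6⟩ := exists_Icc_of_le hg hpq huv hgp hgq
    exact ⟨a, b, hp.1.trans h1, h2, h3.trans hq.2, h4, Or.inl ⟨h5, h6⟩⟩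
  · obtain ⟨a, b, h1, h2, h3, h4, h5, h6⟩ := exists_Icc_of_le (g := fun x => g (-x))
      (p := -p) (q := -q) (hg.comp continuous_neg) (neg_le_neg hqp) huv (by simpa using hgp)
      (by simpa using hgq)
    refine ⟨-b, -a, by linarith [hq.1], by linarith, by linarith [hp.2], fun x hx => ?_,
      Or.inr ⟨h6, h5⟩⟩
    have := h4 (x := -x) ⟨by linarith [hx.2], by linarith [hx.1]⟩
    simpa using this

/-- The interval is obtained by pulling back from the end of the chain. That its end points are sent
to the end points of the last interval is what produces a fixed point when the chain closes up. -/
theorem exists_chain {g : ℝ → ℝ} (hg : Continuous g) (n : ℕ) (l r : ℕ → ℝ) (hlr : ∀ i, l i ≤ r i)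
    (h : ∀ i < n, Icc (l (i + 1)) (r (i + 1)) ⊆ g '' Icc (l i) (r i)) :
    ∃ u v, l 0 ≤ u ∧ u ≤ v ∧ v ≤ r 0 ∧ (∀ i ≤ n, MapsTo g^[i] (Icc u v) (Icc (l i) (r i))) ∧
      (g^[n] u = l n ∧ g^[n] v = r n ∨ g^[n] u = r n ∧ g^[n] v = l n) := by
  induction n generalizing l r with
  | zero =>
    refine ⟨l 0, r 0, le_rfl, hlr 0, le_rfl, fun i hi => ?_, Or.inl ⟨rfl, rfl⟩⟩
    obtain rfl : i = 0 := by omega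
    exact mapsTo_id _
  | succ n ih =>
    obtain ⟨u, v, h1, h2, h3, h4, h5⟩ := ih (fun i => l (i + 1)) (fun i => r (i + 1))
      (fun i => hlr _) (fun i hi => h (i + 1) (by omega))
    obtain ⟨a, b, k1, k2, k3, k4, k5⟩ := exists_Icc_of_subset_image hg h2
      ((Icc_subset_Icc h1 h3).trans (h 0 (by omega)))
    refine ⟨a, b, k1, k2, k3, fun i hi => ?_, ?_⟩
    · rcases i with _ | i
      · exact fun x hx => ⟨k1.trans hx.1, hx.2.trans k3⟩
      · rw [Function.iterate_succ]
        exact (h4 i (by omega)).comp k4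
    · simp only [Function.iterate_succ_apply]
      rcases k5 with ⟨e1, e2⟩ | ⟨e1, e2⟩ <;> rw [e1, e2] <;> tauto

theorem exists_periodic_of_cover {g : ℝ → ℝ} (hg : Continuous g) (n : ℕ) (l r : ℕ → ℝ)
    (hlr : ∀ i, l i ≤ r i) (h : ∀ i < n, Icc (l (i + 1)) (r (i + 1)) ⊆ g '' Icc (l i) (r i))
    (hl : l n = l 0) (hr : r n = r 0) :
    ∃ x, g^[n] x = x ∧ ∀ i ≤ n, g^[i] x ∈ Icc (l i) (r i) := by
  obtain ⟨u, v, h1, h2, h3, h4, h5⟩ := exists_chain hg n l r hlr h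
  have hc : ContinuousOn (fun x => g^[n] x - x) (Icc u v) :=
    ((hg.iterate n).sub continuous_id).continuousOn
  rw [hl, hr] at h5
  have : (0 : ℝ) ∈ (fun x => g^[n] x - x) '' Icc u v := by
    rcases h5 with ⟨e1, e2⟩ | ⟨e1, e2⟩
    · exact intermediate_value_Icc h2 hc ⟨by simp only [e1]; linarith, by simp only [e2]; linarith⟩
    · exact intermediate_value_Icc' h2 hc ⟨by simp only [e2]; linarith, by simp only [e1]; linarith⟩
  obtain ⟨x, hx, hx0⟩ := this
  exact ⟨x, sub_eq_zero.1 hx0, fun i hi => h4 i hi hx⟩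

/-- A horseshoe has points of every period. -/
theorem exists_minimalPeriod_of_horseshoe {g : ℝ → ℝ} (hg : Continuous g) {z₁ b a z₂ : ℝ}
    (h1 : z₁ ≤ b) (h2 : b < a) (h3 : a ≤ z₂) (e1 : g z₁ ≤ z₁) (e2 : z₂ ≤ g b) (e3 : g a ≤ z₁)
    (hb : a < g b) (j : ℕ) (hj : 0 < j) : ∃ x, Function.minimalPeriod g x = j := by
  have c0 : Icc z₁ z₂ ⊆ g '' Icc z₁ b := fun y hy =>
    intermediate_value_Icc h1 hg.continuousOn ⟨e1.trans hy.1, hy.2.trans e2⟩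
  have c1 : Icc z₁ z₂ ⊆ g '' Icc b a := fun y hy =>
    intermediate_value_Icc' h2.le hg.continuousOn ⟨e3.trans hy.1, hy.2.trans e2⟩
  -- The loop spends one step in `[z₁, b]` and the other `j - 1` in `[b, a]`; each of the two covers
  -- `[z₁, z₂]`, which contains both.
  obtain ⟨x, hx, hi⟩ := exists_periodic_of_cover hg j (fun i => if i % j = 0 then z₁ else b)
    (fun i => if i % j = 0 then b else a) (fun i => by split_ifs; exacts [h1, h2.le])
    (fun i _ => by
      refine Subset.trans (Icc_subset_Icc ?_ ?_ : _ ⊆ Icc z₁ z₂) ?_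
      · split_ifs; exacts [le_rfl, h1]
      · split_ifs; exacts [h2.le.trans h3, h3]
      · split_ifs; exacts [c0, c1]) (by simp) (by simp)
  refine ⟨x, ?_⟩
  have hper : Function.IsPeriodicPt g j x := hx
  refine le_antisymm (hper.minimalPeriod_le hj) (not_lt.1 fun hlt => ?_)
  have hp := hper.minimalPeriod_pos hj
  set i := Function.minimalPeriod g x with hi'
  have hxi : g^[i] x = x := Function.iterate_minimalPeriod
  have m0 := hi 0 hj.le
  have mi := hi i hlt.le
  have m1 := hi 1 hj
  simp only [Nat.zero_mod, if_true, Function.iterate_zero, id] at m0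
  rw [Nat.mod_eq_of_lt hlt, if_neg hp.ne', if_neg hp.ne', hxi] at mi
  rw [Nat.mod_eq_of_lt (by omega), if_neg one_ne_zero, if_neg one_ne_zero,
    Function.iterate_one] at m1
  -- A shorter period would put `x` in both intervals, so at `b`; but `b` is sent beyond `a`, out of
  -- the itinerary.
  have : x = b := le_antisymm m0.2 mi.1
  rw [this] at m1
  exact absurd hb (not_lt.2 m1.2)

/-- Points following a prescribed sequence of closed sets exist as soon as they exist for every
finite time. -/
theorem exists_itinerary {g : ℝ → ℝ} (hg : Continuous g) (K : ℕ → Set ℝ) (hK : ∀ i, IsClosed (K i))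
    (hK0 : IsCompact (K 0)) (h : ∀ n, ∃ x, ∀ i ≤ n, g^[i] x ∈ K i) : ∃ x, ∀ i, g^[i] x ∈ K i := by
  have hcl : ∀ n, IsClosed {x | ∀ i ≤ n, g^[i] x ∈ K i} := fun n => by
    simp only [ofPred_forall]
    exact isClosed_iInter fun i => isClosed_iInter fun _ => (hK i).preimage (hg.iterate i)
  obtain ⟨x, hx⟩ := IsCompact.nonempty_iInter_of_sequence_nonempty_isCompact_isClosed
    (fun n => {x | ∀ i ≤ n, g^[i] x ∈ K i}) (fun n x hx i hi => hx i (by omega)) h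
    (hK0.of_isClosed_subset (hcl 0) fun x hx => by simpa using hx 0 le_rfl) hcl
  exact ⟨x, fun i => mem_iInter.1 hx i i le_rfl⟩

/-! ## Reflection -/

/-- The conjugate of `f` by the reflection `x ↦ -x`. -/
def reflect (f : ℝ → ℝ) : ℝ → ℝ := fun x => -f (-x)

theorem reflect_reflect (f : ℝ → ℝ) : reflect (reflect f) = f := by
  funext x; simp [reflect]

theorem reflect_iterate (f : ℝ → ℝ) (n : ℕ) (x : ℝ) : (reflect f)^[n] x = -f^[n] (-x) := by
  induction n with
  | zero => simp
  | succ n ih => simp [Function.iterate_succ_apply', ih, reflect]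

theorem IsLift.reflect {f : ℝ → ℝ} (hf : IsLift f) : IsLift (reflect f) := by
  refine ⟨(hf.cont.comp continuous_neg).neg, fun x => ?_⟩
  have := hf.map_add_one (-(x + 1))
  simp only [SigmaMaps.reflect]
  rw [show -(x + 1) + 1 = -x by ring] at this
  linarith

theorem RotNum.reflect {f : ℝ → ℝ} {x ρ : ℝ} (h : RotNum f x ρ) :
    RotNum (reflect f) (-x) (-ρ) := by
  have h' := Tendsto.neg h
  refine h'.congr fun n => ?_
  rw [reflect_iterate, neg_neg]; ring

theorem rotNum_reflect_iff {f : ℝ → ℝ} {x ρ : ℝ} :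
    RotNum (reflect f) x ρ ↔ RotNum f (-x) (-ρ) := by
  refine ⟨fun h => ?_, fun h => ?_⟩
  · simpa [reflect_reflect] using h.reflect
  · simpa using h.reflect

theorem isPer_reflect_iff {f : ℝ → ℝ} {x : ℝ} {n : ℕ+} :
    IsPer (reflect f) x n ↔ IsPer f (-x) n := by
  have : ∀ i, Returns (reflect f) x i ↔ Returns f (-x) i := fun i => by
    constructor
    · rintro ⟨k, hk⟩
      rw [reflect_iterate] at hk
      exact ⟨-k, by push_cast; linarith⟩
    · rintro ⟨k, hk⟩
      exact ⟨-k, by rw [reflect_iterate]; push_cast; linarith⟩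
  simp only [IsPer, this]

/-! ## Points moving in both directions -/

theorem RotNum.iterate_sub {f : ℝ → ℝ} (hf : IsLift f) {x c : ℝ} (h : RotNum f x c) {q : ℕ}
    (hq : 0 < q) (k : ℤ) : RotNum (fun y => f^[q] y - k) x (q * c - k) := by
  have h1 : Tendsto (fun j : ℕ => q * j) atTop atTop := tendsto_id.const_mul_atTop' hq
  have h2 := ((h.comp h1).const_mul (q : ℝ)).sub_const (k : ℝ)
  refine h2.congr' ?_
  filter_upwards [eventually_gt_atTop 0] with j hj
  have hj' : (0 : ℝ) < j := by exact_mod_cast hj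
  have hq' : (0 : ℝ) < q := by exact_mod_cast hq
  simp only [Function.comp, hf.iterate_mul q k]
  push_cast
  field_simp
  ring

theorem RotNum.add_int {f : ℝ → ℝ} (hf : IsLift f) {x c : ℝ} (h : RotNum f x c) (k : ℤ) :
    RotNum f (x + k) c := by
  refine h.congr fun n => ?_
  rw [hf.iterate_add_int]; ring

/-- Otherwise `[x, ∞)` is invariant, and an integer translate of `x₀` inside it cannot drift to the
left. -/
theorem IsLift.exists_lt_of_rotNum_neg {g : ℝ → ℝ} (hg : IsLift g) {x₀ c : ℝ}
    (h : RotNum g x₀ c) (hc : c < 0) (x : ℝ) : ∃ y, x ≤ y ∧ g y < x := by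
  by_contra! hcon
  have hinv : ∀ (n : ℕ) (y : ℝ), x ≤ y → x ≤ g^[n] y := by
    intro n
    induction n with
    | zero => exact fun y hy => hy
    | succ n ih => exact fun y hy => by rw [Function.iterate_succ_apply]; exact ih _ (hcon y hy)
  have h1 := h.add_int hg ⌈x - x₀⌉
  have h2 : x ≤ x₀ + ⌈x - x₀⌉ := by linarith [Int.le_ceil (x - x₀)]
  have := h1.ge_of_le (σ := 0) (C := x₀ + ⌈x - x₀⌉ - x) fun i => by
    have := hinv i _ h2
    linarith
  linarith

theorem IsLift.exists_gt_of_rotNum_pos {g : ℝ → ℝ} (hg : IsLift g) {x₀ c : ℝ}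
    (h : RotNum g x₀ c) (hc : 0 < c) (x : ℝ) : ∃ y, y ≤ x ∧ x < g y := by
  obtain ⟨y, h1, h2⟩ := hg.reflect.exists_lt_of_rotNum_neg h.reflect (by linarith) (-x)
  refine ⟨-y, by linarith, ?_⟩
  simp only [SigmaMaps.reflect] at h2
  linarith

/-- A pair `b < a` maximizing the drop `g b - g a`. -/
theorem IsLift.exists_max_drop {g : ℝ → ℝ} (hg : IsLift g)
    (hdown : ∀ x, ∃ y, x ≤ y ∧ g y < x) (hup : ∀ x, ∃ y, y ≤ x ∧ x < g y) :
    ∃ b a, b < a ∧ (∀ y ≤ a, g y ≤ g b) ∧ (∀ y, b ≤ y → g a ≤ g y) := by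
  have hcpt : IsCompact {p : ℝ × ℝ | p.1 ∈ Icc (0 : ℝ) 1 ∧ p.2 - p.1 ∈ Icc (0 : ℝ) 1} := by
    refine ((isCompact_Icc (a := (0 : ℝ)) (b := 1)).prod (isCompact_Icc (a := (0 : ℝ)) (b := 2))).of_isClosed_subset ?_ ?_
    · exact (isClosed_Icc.preimage continuous_fst).inter
        (isClosed_Icc.preimage (continuous_snd.sub continuous_fst))
    · rintro ⟨p, q⟩ ⟨h1, h2⟩
      simp only [mem_Icc] at h1 h2
      exact ⟨h1, by constructor <;> dsimp only <;> linarith⟩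
  obtain ⟨⟨b, a⟩, ⟨-, hab⟩, hmax⟩ := hcpt.exists_isMaxOn ⟨(0, 0), by simp⟩
    (f := fun p : ℝ × ℝ => g p.1 - g p.2)
    ((hg.cont.comp continuous_fst).sub (hg.cont.comp continuous_snd)).continuousOn
  -- The compact maximum is global: translating both points by an integer preserves the drop, and
  -- moving `z` left by `⌊z - y⌋ ≥ 0` can only increase it.
  have key : ∀ y z, y ≤ z → g y - g z ≤ g b - g a := by
    intro y z hyz
    have h1 := hmax (a := (Int.fract y, Int.fract y + Int.fract (z - y)))
      ⟨⟨Int.fract_nonneg _, (Int.fract_lt_one _).le⟩, by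
        simp only [add_sub_cancel_left]
        exact ⟨Int.fract_nonneg _, (Int.fract_lt_one _).le⟩⟩
    simp only [mem_ofPred_eq] at h1
    have h2 : g y = g (Int.fract y) + ⌊y⌋ := by
      rw [← hg.map_add_int, Int.fract_add_floor]
    have h3 : g z = g (Int.fract y + Int.fract (z - y)) + (⌊y⌋ + ⌊z - y⌋ : ℤ) := by
      rw [← hg.map_add_int]
      congr 1
      push_cast
      linarith [Int.fract_add_floor y, Int.fract_add_floor (z - y)]
    have h4 : (0 : ℝ) ≤ ⌊z - y⌋ := by exact_mod_cast Int.floor_nonneg.2 (by linarith)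
    push_cast at h3
    linarith
  have hab : b ≤ a := by linarith [hab.1]
  have ha : ∀ y ≤ a, g y ≤ g b := fun y hy => by linarith [key y a hy]
  have hb : ∀ y, b ≤ y → g a ≤ g y := fun y hy => by linarith [key b y hy]
  refine ⟨b, a, lt_of_le_of_ne hab ?_, ha, hb⟩
  rintro rfl
  obtain ⟨y, hy, hy'⟩ := hup b
  obtain ⟨z, hz, hz'⟩ := hdown b
  linarith [ha y hy, hb z hz]

/-- Some `z₂ ≤ g b` is sent beyond `g b`, the maximum of `g` on `(-∞, a]`, so `z₂` lies to the right
of `a`. Symmetrically some `z₁ ≥ g a` lies to the left of `b`. Then `[z₁, b]` and `[b, a]` form a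
horseshoe. -/
theorem IsLift.exists_minimalPeriod {g : ℝ → ℝ} (hg : IsLift g)
    (hdown : ∀ x, ∃ y, x ≤ y ∧ g y < x) (hup : ∀ x, ∃ y, y ≤ x ∧ x < g y) {j : ℕ} (hj : 0 < j) :
    ∃ x, Function.minimalPeriod g x = j := by
  obtain ⟨b, a, hba, hmax, hmin⟩ := hg.exists_max_drop hdown hup
  obtain ⟨p, hp, hp'⟩ := hup a
  obtain ⟨r, hr, hr'⟩ := hdown b
  have h1 : a < g b := hp'.trans_le (hmax p hp)
  have h2 : g a < b := (hmin r hr).trans_lt hr'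
  obtain ⟨z₂, h3, h4⟩ := hup (g b)
  obtain ⟨z₁, h5, h6⟩ := hdown (g a)
  have h7 : a < z₂ := not_le.1 fun h => absurd (hmax _ h) (not_le.2 h4)
  have h8 : z₁ < b := not_le.1 fun h => absurd (hmin _ h) (not_le.2 h6)
  exact exists_minimalPeriod_of_horseshoe hg.cont h8.le hba h7.le (h6.le.trans h5) h3 h5 h1 j hj

/-- All the periods in `M(c, d)` occur as soon as `c` and `d` are rotation numbers. -/
theorem IsLift.exists_isPer_of_mem_M {f : ℝ → ℝ} (hf : IsLift f) {x₀ x₁ c d : ℝ}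
    (h0 : RotNum f x₀ c) (h1 : RotNum f x₁ d) {N : ℕ+} (hN : N ∈ M c d) : ∃ x, IsPer f x N := by
  obtain ⟨K, hc, hd⟩ := hN
  have hg : 0 < Int.gcd K N := Int.gcd_pos_of_ne_zero_right _ (by exact_mod_cast N.ne_zero)
  -- The fraction `K / N` need not be reduced: with `N = n * q` and `K = k * q`, the period `N`
  -- comes from a point of least period `q` of `f^n - k`.
  obtain ⟨k, n, hkn, hK, hn⟩ := Int.exists_gcd_one hg
  set q := Int.gcd K N
  have hq' : (0 : ℤ) < q := by exact_mod_cast hg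
  have hN' : (0 : ℤ) < (N : ℤ) := by exact_mod_cast N.pos
  have hn0 : 0 < n := by
    rw [hn] at hN'
    exact pos_of_mul_pos_left hN' hq'.le
  lift n to ℕ using hn0.le
  have hn0 : 0 < n := by exact_mod_cast hn0
  have hNn : N = Nat.toPNat n hn0 * Nat.toPNat q hg := by
    apply PNat.eq
    have h : (N : ℕ) = n * q := by exact_mod_cast hn
    exact h
  have hr : (K : ℝ) / (N : ℕ) = k / n := by
    have e1 : (K : ℝ) = k * q := by exact_mod_cast hK
    have e2 : ((N : ℕ) : ℝ) = n * q := by exact_mod_cast hn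
    have e3 : (q : ℝ) ≠ 0 := by positivity
    rw [e1, e2, mul_div_mul_right _ _ e3]
  rw [hr] at hc hd
  have hn' : (0 : ℝ) < n := by exact_mod_cast hn0
  rw [lt_div_iff₀ hn'] at hc
  rw [div_lt_iff₀ hn'] at hd
  have hG := (hf.iterate n).sub_int k
  obtain ⟨x, hx⟩ := hG.exists_minimalPeriod
    (hG.exists_lt_of_rotNum_neg (h0.iterate_sub hf hn0 k) (by linarith))
    (hG.exists_gt_of_rotNum_pos (h1.iterate_sub hf hn0 k) (by linarith)) hg
  refine ⟨x, ?_⟩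
  rw [hNn]
  exact hf.isPer_of_minimalPeriod (k := k) (n := Nat.toPNat n hn0)
    (Int.isCoprime_iff_gcd_eq_one.2 (by exact_mod_cast hkn)) hx

/-! ## Intermediate rotation numbers -/

theorem IsLift.exists_bound {f : ℝ → ℝ} (hf : IsLift f) : ∃ C, ∀ x, |f x - x| ≤ C := by
  obtain ⟨C, hC⟩ := isCompact_Icc.exists_bound_of_continuousOn (s := Icc (0 : ℝ) 1)
    (f := fun x => f x - x) (hf.cont.sub continuous_id).continuousOn
  refine ⟨C, fun x => ?_⟩
  have h1 := hC (Int.fract x) ⟨Int.fract_nonneg _, (Int.fract_lt_one _).le⟩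
  have h2 := hf.map_add_int (Int.fract x) ⌊x⌋
  rw [Int.fract_add_floor] at h2
  rw [Real.norm_eq_abs] at h1
  rwa [h2, show f (Int.fract x) + ⌊x⌋ - x = f (Int.fract x) - Int.fract x by
    rw [Int.fract]; ring]

theorem RotNum.of_iterate_sub {f : ℝ → ℝ} (hf : IsLift f) {x θ C : ℝ} {q : ℕ} (hq : 0 < q) {k : ℤ}
    (h : ∀ i : ℕ, |(fun y => f^[q] y - k)^[i] x - x - i * θ| ≤ C) :
    RotNum f x ((k + θ) / q) := by
  choose B hB using fun r : ℕ => (hf.iterate r).exists_bound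
  have hB0 : ∀ r, 0 ≤ B r := fun r => (abs_nonneg _).trans (hB r 0)
  have hq' : (0 : ℝ) < q := by exact_mod_cast hq
  refine RotNum.of_bounded
    (C := C + ∑ r ∈ Finset.range q, B r + q * |(k + θ) / q|) fun i => ?_
  have h0 := Nat.mod_add_div i q
  have hr := Nat.mod_lt i hq
  set r := i % q
  set e := i / q
  have e1 : f^[i] x = f^[r] (f^[q * e] x) := by rw [← h0, Function.iterate_add_apply]
  have e2 := hf.iterate_mul q k e x
  have b1 := hB r (f^[q * e] x)
  have b2 := h e
  have b3 : B r ≤ ∑ r ∈ Finset.range q, B r :=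
    Finset.single_le_sum (fun r _ => hB0 r) (Finset.mem_range.2 hr)
  have e3 : (i : ℝ) = r + q * e := by exact_mod_cast h0.symm
  have e4 : f^[i] x - x - i * ((k + θ) / q) = (f^[r] (f^[q * e] x) - f^[q * e] x)
      + ((fun y => f^[q] y - k)^[e] x - x - e * θ) - r * ((k + θ) / q) := by
    rw [e1, e3]
    nth_rewrite 3 [e2]
    push_cast
    field_simp
    ring
  have b4 : |r * ((k + θ) / q)| ≤ q * |(k + θ) / q| := by
    rw [abs_mul, Nat.abs_cast]
    exact mul_le_mul_of_nonneg_right (by exact_mod_cast hr.le) (abs_nonneg _)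
  rw [e4]
  calc _ ≤ _ := abs_sub _ _
    _ ≤ _ := add_le_add (abs_add_le _ _) b4
    _ ≤ _ := by linarith

/-- For large `q'`, the map `g = f^q' - k` with `k = ⌊q' * ρ⌋` moves some points left and others
right by more than one, so the drop pair gives an interval `[b, a]` covering `[b, a + 1]`. A point
that follows the translates of `[b, a]` by `⌊i * θ⌋`, where `θ` is the fractional part of `q' * ρ`,
stays within a bounded distance of drift `θ`. -/
theorem IsLift.exists_rotNum {f : ℝ → ℝ} (hf : IsLift f) {x₀ x₁ c d ρ : ℝ}
    (h0 : RotNum f x₀ c) (h1 : RotNum f x₁ d) (hcρ : c < ρ) (hρd : ρ < d) :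
    ∃ x, RotNum f x ρ := by
  -- The bounds on `q'` ensure `q' * c < k` and `k + 1 < q' * d`.
  obtain ⟨q', hq'⟩ := exists_nat_gt (max (1 / (ρ - c)) (1 / (d - ρ)))
  have hqc := (le_max_left _ _).trans_lt hq'
  have hqd := (le_max_right _ _).trans_lt hq'
  rw [div_lt_iff₀ (by linarith)] at hqc hqd
  have hq0 : 0 < q' := by
    rcases Nat.eq_zero_or_pos q' with rfl | h
    · norm_num at hqc
    · exact h
  set k := ⌊q' * ρ⌋
  set θ := Int.fract (q' * ρ)
  have hθ0 : 0 ≤ θ := Int.fract_nonneg _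
  have hθ1 : θ < 1 := Int.fract_lt_one _
  have hkθ : k + θ = q' * ρ := Int.floor_add_fract _
  have hG := (hf.iterate q').sub_int k
  have hG1 := (hf.iterate q').sub_int (k + 1)
  have hdown := hG.exists_lt_of_rotNum_neg (h0.iterate_sub hf hq0 k) (by nlinarith)
  have hup1 := hG1.exists_gt_of_rotNum_pos (h1.iterate_sub hf hq0 (k + 1))
    (by push_cast; nlinarith)
  have hup : ∀ x, ∃ y, y ≤ x ∧ x + 1 < f^[q'] y - k := fun x => by
    obtain ⟨y, hy, h⟩ := hup1 x
    push_cast at h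
    exact ⟨y, hy, by linarith⟩
  obtain ⟨b, a, hba, hmax, hmin⟩ := hG.exists_max_drop hdown fun x => by
    obtain ⟨y, hy, h⟩ := hup x
    exact ⟨y, hy, by linarith⟩
  obtain ⟨p, hp, hp'⟩ := hup a
  obtain ⟨r, hr, hr'⟩ := hdown b
  have hgb := hp'.trans_le (hmax p hp)
  have hga := (hmin r hr).trans_lt hr'
  set g := fun y => f^[q'] y - k
  have hcov : Icc b (a + 1) ⊆ g '' Icc b a := fun y hy =>
    intermediate_value_Icc' hba.le hG.cont.continuousOn ⟨hga.le.trans hy.1, hy.2.trans hgb.le⟩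
  have hcov' : ∀ (s t : ℤ), s ≤ t → t ≤ s + 1 →
      Icc (b + t) (a + t) ⊆ g '' Icc (b + s) (a + s) := by
    intro s t hst hts y hy
    have e1 : (s : ℝ) ≤ t := by exact_mod_cast hst
    have e2 : (t : ℝ) ≤ s + 1 := by exact_mod_cast hts
    obtain ⟨x, hx, hgx⟩ := hcov (a := y - s) ⟨by linarith [hy.1], by linarith [hy.2]⟩
    refine ⟨x + s, ⟨by linarith [hx.1], by linarith [hx.2]⟩, ?_⟩
    rw [hG.map_add_int]
    linarith
  have hstep : ∀ i : ℕ, ⌊i * θ⌋ ≤ ⌊((i + 1 : ℕ) : ℝ) * θ⌋ ∧ ⌊((i + 1 : ℕ) : ℝ) * θ⌋ ≤ ⌊i * θ⌋ + 1 := by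
    intro i
    rw [← Int.floor_add_one]
    constructor <;> apply Int.floor_mono <;> push_cast <;> linarith
  obtain ⟨x, hx⟩ := exists_itinerary hG.cont
    (fun i => Icc (b + ⌊(i : ℝ) * θ⌋) (a + ⌊(i : ℝ) * θ⌋)) (fun _ => isClosed_Icc) isCompact_Icc
    fun n => by
      obtain ⟨u, v, h1, h2, h3, h4, -⟩ := exists_chain hG.cont n (fun i => b + ⌊(i : ℝ) * θ⌋)
        (fun i => a + ⌊(i : ℝ) * θ⌋) (fun i => by linarith)
        fun i _ => hcov' _ _ (hstep i).1 (hstep i).2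
      exact ⟨u, fun i hi => h4 i hi (left_mem_Icc.2 h2)⟩
  refine ⟨x, ?_⟩
  have hq'' : (q' : ℝ) ≠ 0 := by positivity
  have : ρ = (k + θ) / q' := by rw [hkθ]; field_simp
  rw [this]
  refine RotNum.of_iterate_sub hf hq0 (C := a - b + 1) fun i => ?_
  have m0 := hx 0
  have mi := hx i
  simp only [Nat.cast_zero, zero_mul, Int.floor_zero, Int.cast_zero, add_zero, Function.iterate_zero,
    id] at m0
  have f1 := Int.floor_le (i * θ)
  have f2 := Int.lt_floor_add_one (i * θ)
  rw [abs_le]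
  constructor <;> linarith [m0.1, m0.2, mi.1, mi.2]

end SigmaMaps

namespace SigmaMaps

open Filter Topology Set Function

/-! ## The Sharkovsky ordering in terms of exponents and odd parts -/

theorem two_pow_mul_odd_inj {a b p q : ℕ} (hp : Odd p) (hq : Odd q) (h : 2 ^ a * p = 2 ^ b * q) :
    a = b ∧ p = q := by
  have key : ∀ {a b p q : ℕ}, Odd p → 2 ^ a * p = 2 ^ b * q → b ≤ a := by
    intro a b p q hp h
    have h1 : 2 ^ b ∣ 2 ^ a * p := Dvd.intro _ h.symm
    have h2 : Nat.Coprime (2 ^ b) p := (Nat.coprime_two_left.2 hp).pow_left b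
    exact (Nat.pow_dvd_pow_iff_le_right (by norm_num)).1 (h2.dvd_of_dvd_mul_right h1)
  obtain rfl : a = b := le_antisymm (key hq h.symm) (key hp h)
  exact ⟨rfl, Nat.eq_of_mul_eq_mul_left (by positivity) h⟩

/-- Unique factorization as a power of two times an odd number turns the ordering into linear
arithmetic, so that the facts below are settled by `omega`. -/
theorem shLE_num_iff {k m : ℕ+} {a b p q : ℕ} (hp : Odd p) (hq : Odd q)
    (hk : (k : ℕ) = 2 ^ a * p) (hm : (m : ℕ) = 2 ^ b * q) :
    ShLE (.num k) (.num m) ↔ (p = 1 ∧ q = 1 ∧ a ≤ b) ∨ (p = 1 ∧ 1 < q) ∨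
      (1 < p ∧ 1 < q ∧ (b < a ∨ a = b ∧ q ≤ p)) := by
  have hp0 := hp.pos
  have hq0 := hq.pos
  constructor
  · rintro (h | h)
    · cases h
      obtain ⟨rfl, rfl⟩ := two_pow_mul_odd_inj hp hq (hk.symm.trans hm)
      omega
    · cases h with
      | sameExponent _ _ a' p' q' hp' hq' h1 h2 hk' hm' =>
        obtain ⟨rfl, rfl⟩ := two_pow_mul_odd_inj hp hp' (hk.symm.trans hk')
        obtain ⟨rfl, rfl⟩ := two_pow_mul_odd_inj hq hq' (hm.symm.trans hm')
        omega
      | largerExponent _ _ a' b' p' q' hp' hq' h1 h2 h3 hk' hm' =>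
        obtain ⟨rfl, rfl⟩ := two_pow_mul_odd_inj hp hp' (hk.symm.trans hk')
        obtain ⟨rfl, rfl⟩ := two_pow_mul_odd_inj hq hq' (hm.symm.trans hm')
        omega
      | powLT _ _ a' b' q' hq' h1 hk' hm' =>
        obtain ⟨rfl, rfl⟩ := two_pow_mul_odd_inj hp odd_one
          (hk.symm.trans (hk'.trans (mul_one _).symm))
        obtain ⟨rfl, rfl⟩ := two_pow_mul_odd_inj hq hq' (hm.symm.trans hm')
        omega
      | powLTPow _ _ a' b' h1 hk' hm' =>
        obtain ⟨rfl, rfl⟩ := two_pow_mul_odd_inj hp odd_one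
          (hk.symm.trans (hk'.trans (mul_one _).symm))
        obtain ⟨rfl, rfl⟩ := two_pow_mul_odd_inj hq odd_one
          (hm.symm.trans (hm'.trans (mul_one _).symm))
        omega
  · rintro (⟨rfl, rfl, h⟩ | ⟨rfl, h⟩ | ⟨h1, h2, h | ⟨rfl, h⟩⟩)
    · rw [mul_one] at hk hm
      rcases h.eq_or_lt with rfl | h
      · exact Or.inl (congrArg _ (PNat.eq (hk.trans hm.symm)))
      · exact Or.inr (.powLTPow _ _ a b h hk hm)
    · rw [mul_one] at hk
      exact Or.inr (.powLT _ _ a b q hq h hk hm)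
    · exact Or.inr (.largerExponent _ _ a b p q hp hq h1 h2 h hk hm)
    · rcases h.eq_or_lt with rfl | h
      · exact Or.inl (congrArg _ (PNat.eq (hk.trans hm.symm)))
      · exact Or.inr (.sameExponent _ _ a p q hp hq h2 h hk hm)

theorem shLE_twoInf_iff {k : ℕ+} {a p : ℕ} (hp : Odd p) (hk : (k : ℕ) = 2 ^ a * p) :
    ShLE (.num k) .twoInf ↔ p = 1 := by
  constructor
  · rintro (h | h)
    · cases h
    · cases h with
      | powLTTwoInf _ a' hk' =>
        exact (two_pow_mul_odd_inj hp odd_one (hk.symm.trans (hk'.trans (mul_one _).symm))).2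
  · rintro rfl
    rw [mul_one] at hk
    exact Or.inr (.powLTTwoInf _ a hk)

theorem exists_two_pow_mul_odd (k : ℕ+) : ∃ a p : ℕ, Odd p ∧ (k : ℕ) = 2 ^ a * p := by
  obtain ⟨a, p, hp, h⟩ := Nat.exists_eq_two_pow_mul_odd k.ne_zero
  exact ⟨a, p, hp, h⟩

theorem Sh_num_subset {k : ℕ+} {s : NSh} (h : k ∈ Sh s) : Sh (.num k) ⊆ Sh s := by
  intro j hj
  obtain ⟨a, p, hp, hk⟩ := exists_two_pow_mul_odd k
  obtain ⟨b, q, hq, hj'⟩ := exists_two_pow_mul_odd j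
  have h1 := (shLE_num_iff hq hp hj' hk).1 hj
  cases s with
  | num m =>
    obtain ⟨c, r, hr, hm⟩ := exists_two_pow_mul_odd m
    have h2 := (shLE_num_iff hp hr hk hm).1 h
    exact (shLE_num_iff hq hr hj' hm).2 (by omega)
  | twoInf =>
    have h2 := (shLE_twoInf_iff hp hk).1 h
    exact (shLE_twoInf_iff hq hj').2 (by omega)

theorem one_mem_Sh (s : NSh) : 1 ∈ Sh s := by
  cases s with
  | num m =>
    obtain ⟨c, r, hr, hm⟩ := exists_two_pow_mul_odd m
    have := hr.pos
    exact (shLE_num_iff (a := 0) odd_one hr (by simp) hm).2 (by omega)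
  | twoInf => exact (shLE_twoInf_iff (a := 0) odd_one (by simp)).2 rfl

theorem two_mul_mem_Sh {k n : ℕ+} (h : k ∈ Sh (.num n)) : 2 * k ∈ Sh (.num (2 * n)) := by
  obtain ⟨a, p, hp, hk⟩ := exists_two_pow_mul_odd k
  obtain ⟨b, q, hq, hn⟩ := exists_two_pow_mul_odd n
  have h1 := (shLE_num_iff hp hq hk hn).1 h
  refine (shLE_num_iff (a := a + 1) (b := b + 1) hp hq ?_ ?_).2 (by omega)
  · rw [PNat.mul_coe, hk, pow_succ]; change 2 * _ = _; ring
  · rw [PNat.mul_coe, hn, pow_succ]; change 2 * _ = _; ring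

theorem mem_Sh_of_odd {n m : ℕ+} (hn : Odd (n : ℕ)) (hn1 : 1 < (n : ℕ))
    (h : m = 1 ∨ Even (m : ℕ) ∨ n ≤ m) : m ∈ Sh (.num n) := by
  obtain ⟨a, p, hp, hm⟩ := exists_two_pow_mul_odd m
  refine (shLE_num_iff (b := 0) hp hn hm (by simp)).2 ?_
  have hp0 := hp.pos
  rcases Nat.eq_zero_or_pos a with rfl | ha
  · rw [pow_zero, one_mul] at hm
    rcases h with rfl | h | h
    · simp at hm; omega
    · rw [hm] at h; exact absurd hp (Nat.not_odd_iff_even.2 h)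
    · have h : (n : ℕ) ≤ m := h
      omega
  · omega

/-! ## Periods of interval maps -/

/-- The periods of the periodic points of `f` in `[0, 1]`. -/
def periodSet (f : ℝ → ℝ) : Set ℕ+ := {n | ∃ x ∈ Icc (0 : ℝ) 1, minimalPeriod f x = n}

theorem iterate_conj {α β : Type*} {f : α → α} {g : β → β} {φ : α → β} {s : Set α}
    (hs : MapsTo f s s) (h : ∀ x ∈ s, g (φ x) = φ (f x)) {x : α} (hx : x ∈ s) (n : ℕ) :
    g^[n] (φ x) = φ (f^[n] x) := by
  induction n with
  | zero => rfl
  | succ n ih => rw [iterate_succ_apply', iterate_succ_apply', ih, h _ (hs.iterate n hx)]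

theorem minimalPeriod_conj {α β : Type*} {f : α → α} {g : β → β} {φ : α → β} {s : Set α}
    (hs : MapsTo f s s) (hφ : Injective φ) (h : ∀ x ∈ s, g (φ x) = φ (f x)) {x : α} (hx : x ∈ s) :
    minimalPeriod g (φ x) = minimalPeriod f x := by
  rw [minimalPeriod_eq_minimalPeriod_iff]
  intro n
  rw [IsPeriodicPt, IsFixedPt, iterate_conj hs h hx, hφ.eq_iff]
  rfl

theorem minimalPeriod_iterate_of_pos {α : Type*} {f : α → α} {x : α} {n : ℕ+}
    (h : minimalPeriod f x = n) (i : ℕ) : minimalPeriod f (f^[i] x) = n := by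
  rw [minimalPeriod_apply_iterate (minimalPeriod_pos_iff_mem_periodicPts.1 (h ▸ n.pos)), h]

theorem eq_one_of_isFixedPt {α : Type*} {f : α → α} {x : α} {n : ℕ+} (h : minimalPeriod f x = n)
    (hx : f x = x) : n = 1 := by
  rw [minimalPeriod_eq_one_iff_isFixedPt.2 hx] at h
  exact PNat.eq h.symm

theorem eq_one_of_le_succ {f : ℝ → ℝ} {x : ℝ} {n : ℕ+} (h : minimalPeriod f x = n)
    (hx : ∀ i, f^[i] x ≤ f (f^[i] x)) : n = 1 := by
  have hmono : Monotone fun i => f^[i] x := monotone_nat_of_le_succ fun i => by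
    rw [iterate_succ_apply']; exact hx i
  have h1 : f^[(n : ℕ)] x = x := by rw [← h]; exact iterate_minimalPeriod
  have h2 : f x ≤ f^[(n : ℕ)] x := hmono (a := 1) n.pos
  exact eq_one_of_isFixedPt h (le_antisymm (h2.trans h1.le) (hx 0))

theorem eq_one_of_succ_le {f : ℝ → ℝ} {x : ℝ} {n : ℕ+} (h : minimalPeriod f x = n)
    (hx : ∀ i, f (f^[i] x) ≤ f^[i] x) : n = 1 := by
  have hmono : Antitone fun i => f^[i] x := antitone_nat_of_succ_le fun i => by
    rw [iterate_succ_apply']; exact hx i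
  have h1 : f^[(n : ℕ)] x = x := by rw [← h]; exact iterate_minimalPeriod
  have h2 : f^[(n : ℕ)] x ≤ f x := hmono (a := 1) n.pos
  exact eq_one_of_isFixedPt h (le_antisymm (hx 0) (h1.symm.le.trans h2))

/-! ### Odd periods -/

/-- A piecewise affine map of `[-1, 1]` with a periodic orbit of Štefan type; with `δ = 2 ^ (-k)`
it has a periodic orbit of period `2 k + 1`. -/
noncomputable def stefan (δ x : ℝ) : ℝ := min (max (-x) (-2 * x)) (1 + 2 * (1 + δ) * (x + 1 / 2))

theorem stefan_continuous (δ : ℝ) : Continuous (stefan δ) := by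
  unfold stefan; fun_prop

section stefan

variable {δ : ℝ} (hδ : 0 < δ)
include hδ

theorem stefan_of_nonneg {x : ℝ} (hx : 0 ≤ x) : stefan δ x = -x := by
  rw [stefan, max_eq_left (by linarith), min_eq_left (by nlinarith)]

theorem stefan_of_mem {x : ℝ} (h1 : -(1 / 2) ≤ x) (h2 : x ≤ 0) : stefan δ x = -2 * x := by
  rw [stefan, max_eq_right (by linarith), min_eq_left (by nlinarith)]

theorem stefan_of_le {x : ℝ} (h : x ≤ -(1 / 2)) :
    stefan δ x = 1 + 2 * (1 + δ) * (x + 1 / 2) := by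
  rw [stefan, max_eq_right (by linarith), min_eq_right (by nlinarith)]

theorem stefan_mapsTo (hδ1 : δ ≤ 1) : MapsTo (stefan δ) (Icc (-1) 1) (Icc (-1) 1) := by
  rintro x ⟨h1, h2⟩
  rcases le_total 0 x with h | h
  · rw [stefan_of_nonneg hδ h]; constructor <;> linarith
  · rcases le_total (-(1 / 2)) x with h' | h'
    · rw [stefan_of_mem hδ h' h]; constructor <;> linarith
    · rw [stefan_of_le hδ h']; constructor <;> nlinarith

/-- On `[-1/2, 0]` two steps `z ↦ -2 * z ↦ 2 * z` double the point; the bound `-1 ≤ 2 ^ k * z`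
leaves room for `k` doublings. -/
theorem stefan_iterate {k : ℕ} {z : ℝ} (hz : z < 0) (hk : -1 ≤ 2 ^ k * z) (j : ℕ) (hj : j ≤ k) :
    (stefan δ)^[2 * j] z = 2 ^ j * z ∧ (j < k → (stefan δ)^[2 * j + 1] z = -(2 ^ (j + 1) * z)) := by
  have hlow : ∀ j < k, -(1 / 2) ≤ 2 ^ j * z := fun j hj => by
    have h1 : (2 : ℝ) ^ (j + 1) ≤ 2 ^ k := pow_le_pow_right₀ (by norm_num) hj
    have h2 := mul_le_mul_of_nonpos_right h1 hz.le
    rw [pow_succ] at h2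
    linarith
  have hneg : ∀ j : ℕ, 2 ^ j * z ≤ 0 := fun j =>
    mul_nonpos_of_nonneg_of_nonpos (by positivity) hz.le
  induction j with
  | zero =>
    refine ⟨by simp, fun h => ?_⟩
    have := hlow 0 h
    have := hneg 0
    rw [pow_zero, one_mul] at *
    simp only [mul_zero, zero_add, iterate_one, pow_one]
    rw [stefan_of_mem hδ (by assumption) (by assumption)]
    ring
  | succ j ih =>
    have h1 := (ih (by omega)).2 (by omega)
    have h2 : (stefan δ)^[2 * (j + 1)] z = 2 ^ (j + 1) * z := by
      rw [show 2 * (j + 1) = 2 * j + 1 + 1 by ring, iterate_succ_apply', h1,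
        stefan_of_nonneg hδ (by linarith [hneg (j + 1)]), neg_neg]
    refine ⟨h2, fun h => ?_⟩
    rw [iterate_succ_apply', h2, stefan_of_mem hδ (hlow _ h) (hneg _)]
    ring

end stefan

/-- The orbit is `-1 ↦ -δ ↦ 2 * δ ↦ -2 * δ ↦ ... ↦ -2 ^ k * δ = -1`: one step followed by `k`
doublings of two steps each. -/
theorem stefan_minimalPeriod (k : ℕ) (hk : 0 < k) :
    minimalPeriod (stefan ((1 / 2) ^ k)) (-1) = 2 * k + 1 := by
  set δ : ℝ := (1 / 2) ^ k with hδ'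
  have hδ : 0 < δ := by positivity
  have hkδ : 2 ^ k * δ = 1 := by rw [hδ', ← mul_pow]; norm_num
  have h1 : stefan δ (-1) = -δ := by rw [stefan_of_le hδ (by norm_num)]; ring
  have hit := fun j hj => stefan_iterate (k := k) hδ (z := -δ) (by linarith) (by linarith) j hj
  have hper : IsPeriodicPt (stefan δ) (2 * k + 1) (-1) := by
    rw [IsPeriodicPt, IsFixedPt, iterate_succ_apply, h1, (hit k le_rfl).1]
    linarith
  refine le_antisymm (hper.minimalPeriod_le (by omega)) (not_lt.1 fun hlt => ?_)
  have hp := hper.minimalPeriod_pos (by omega)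
  have hret : (stefan δ)^[minimalPeriod (stefan δ) (-1)] (-1) = -1 := iterate_minimalPeriod
  obtain ⟨i, hi⟩ : ∃ i, minimalPeriod (stefan δ) (-1) = i + 1 := ⟨_, (Nat.succ_pred_eq_of_pos hp).symm⟩
  rw [hi, iterate_succ_apply, h1] at hret
  rcases Nat.even_or_odd' i with ⟨j, rfl | rfl⟩
  · rw [(hit j (by omega)).1] at hret
    have h2 : (2 : ℝ) ^ j < 2 ^ k := pow_lt_pow_right₀ (by norm_num) (by omega)
    nlinarith
  · rw [(hit j (by omega)).2 (by omega)] at hret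
    have : (0 : ℝ) < 2 ^ (j + 1) * δ := by positivity
    linarith

/-- An orbit through `0` is fixed, and one whose signs alternate has even period. Otherwise a
negative `y` has a negative image; then `y < -1/2` and the image is at least `-δ`. An odd return to
`y` consists of that step and doublings, and at least `k` doublings are needed to get from `[-δ, 0)`
below `-1/2`. -/
theorem stefan_period (k : ℕ) {x : ℝ} (hx : x ∈ Icc (-1 : ℝ) 1) {n : ℕ+}
    (h : minimalPeriod (stefan ((1 / 2) ^ k)) x = n) :
    n = 1 ∨ Even (n : ℕ) ∨ 2 * k + 1 ≤ (n : ℕ) := by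
  set δ : ℝ := (1 / 2) ^ k with hδ'
  have hδ : 0 < δ := by positivity
  have hδ1 : δ ≤ 1 := pow_le_one₀ (by norm_num) (by norm_num)
  have hkδ : 2 ^ k * δ = 1 := by rw [hδ', ← mul_pow]; norm_num
  have hinv := stefan_mapsTo hδ hδ1
  have hret : (stefan δ)^[(n : ℕ)] x = x := by rw [← h]; exact iterate_minimalPeriod
  by_cases h0 : ∃ i, (stefan δ)^[i] x = 0
  · obtain ⟨i, hi⟩ := h0
    have h1 := minimalPeriod_iterate_of_pos h i
    rw [hi] at h1
    exact Or.inl (eq_one_of_isFixedPt h1 (by rw [stefan_of_nonneg hδ le_rfl, neg_zero]))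
  push Not at h0
  by_cases hZ : ∃ i, (stefan δ)^[i] x < 0 ∧ stefan δ ((stefan δ)^[i] x) < 0
  · right
    obtain ⟨i, hi1, hi2⟩ := hZ
    have h1 := minimalPeriod_iterate_of_pos h i
    have hy := hinv.iterate i hx
    set y := (stefan δ)^[i] x
    have hret : (stefan δ)^[(n : ℕ)] y = y := by rw [← h1]; exact iterate_minimalPeriod
    have hy2 : y < -(1 / 2) := by
      by_contra! hcon
      rw [stefan_of_mem hδ hcon hi1.le] at hi2
      linarith
    have hz : -δ ≤ stefan δ y := by
      rw [stefan_of_le hδ hy2.le]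
      nlinarith [hy.1]
    have hit := fun j hj => stefan_iterate (k := k) hδ hi2 (by
      have := mul_le_mul_of_nonneg_left hz (by positivity : (0 : ℝ) ≤ 2 ^ k)
      linarith) j hj
    obtain ⟨m, hm⟩ : ∃ m, (n : ℕ) = m + 1 := ⟨_, (Nat.succ_pred_eq_of_pos n.pos).symm⟩
    rw [hm, iterate_succ_apply] at hret
    rw [hm]
    rcases Nat.even_or_odd' m with ⟨j, rfl | rfl⟩
    · right
      by_contra! hlt
      rw [(hit j (by omega)).1] at hret
      have h2 : (2 : ℝ) ^ (j + 1) ≤ 2 ^ k := pow_le_pow_right₀ (by norm_num) (by omega)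
      rw [pow_succ] at h2
      have h3 := mul_le_mul_of_nonpos_right h2 hi2.le
      have h4 := mul_le_mul_of_nonneg_left hz (by positivity : (0 : ℝ) ≤ 2 ^ k)
      linarith
    · left
      exact ⟨j + 1, by ring⟩
  · right; left
    push Not at hZ
    have hsign : ∀ i, (stefan δ)^[i + 2] x < 0 ↔ (stefan δ)^[i] x < 0 := by
      have hstep : ∀ i, (stefan δ)^[i + 1] x < 0 ↔ ¬ (stefan δ)^[i] x < 0 := by
        intro i
        rw [iterate_succ_apply']
        refine ⟨fun h1 h2 => absurd h1 (not_lt.2 (hZ i h2)), fun h1 => ?_⟩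
        rw [stefan_of_nonneg hδ (not_lt.1 h1), neg_lt_zero]
        exact lt_of_le_of_ne (not_lt.1 h1) (h0 i).symm
      intro i
      rw [hstep (i + 1), hstep i, not_not]
    have hsign' : ∀ j, (stefan δ)^[2 * j] x < 0 ↔ x < 0 := by
      intro j
      induction j with
      | zero => simp
      | succ j ih => rw [show 2 * (j + 1) = 2 * j + 2 by ring, hsign, ih]
    by_contra hodd
    obtain ⟨j, hj⟩ : ∃ j, (n : ℕ) = 2 * j + 1 := Nat.not_even_iff_odd.1 hodd
    rw [hj, iterate_succ_apply'] at hret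
    have hne : x ≠ 0 := h0 0
    by_cases hneg : x < 0
    · have := hZ _ ((hsign' j).2 hneg)
      linarith
    · have h3 : 0 ≤ (stefan δ)^[2 * j] x := not_lt.1 fun h => hneg ((hsign' j).1 h)
      rw [stefan_of_nonneg hδ h3] at hret
      exact hne (le_antisymm (by linarith) (not_lt.1 hneg))

/-! ### Existence of a map with a given greatest period -/

theorem exists_map_odd {n : ℕ+} (hn : Odd (n : ℕ)) (hn1 : 1 < (n : ℕ)) :
    ∃ f, Continuous f ∧ MapsTo f (Icc 0 1) (Icc 0 1) ∧ n ∈ periodSet f ∧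
      periodSet f ⊆ Sh (.num n) := by
  obtain ⟨k, hk⟩ := hn
  set δ : ℝ := (1 / 2) ^ k with hδ'
  have hδ : 0 < δ := by positivity
  have hδ1 : δ ≤ 1 := pow_le_one₀ (by norm_num) (by norm_num)
  have hinv := stefan_mapsTo hδ hδ1
  have hconj : ∀ x ∈ Icc (-1 : ℝ) 1,
      minimalPeriod (fun t => (stefan δ (2 * t - 1) + 1) / 2) ((x + 1) / 2)
        = minimalPeriod (stefan δ) x := fun x hx =>
    minimalPeriod_conj (f := stefan δ) (g := fun t => (stefan δ (2 * t - 1) + 1) / 2)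
      (φ := fun x => (x + 1) / 2) hinv (fun x y h => by simpa using h)
      (fun x _ => by rw [show 2 * ((x + 1) / 2) - 1 = x by ring]) hx
  refine ⟨fun t => (stefan δ (2 * t - 1) + 1) / 2, ?_, ?_, ?_, ?_⟩
  · have := stefan_continuous δ
    fun_prop
  · intro t ht
    have := hinv (x := 2 * t - 1) ⟨by linarith [ht.1], by linarith [ht.2]⟩
    constructor <;> linarith [this.1, this.2]
  · refine ⟨0, by simp, ?_⟩
    have := hconj (-1) (by simp)
    rw [stefan_minimalPeriod k (by omega)] at this
    simpa [hk] using this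
  · rintro m ⟨t, ht, hm⟩
    have hx : 2 * t - 1 ∈ Icc (-1 : ℝ) 1 := ⟨by linarith [ht.1], by linarith [ht.2]⟩
    have := hconj _ hx
    rw [sub_add_cancel, mul_div_cancel_left₀ _ two_ne_zero, hm] at this
    refine mem_Sh_of_odd ⟨k, hk⟩ hn1 ?_
    have := stefan_period k hx this.symm
    rwa [← hk] at this

/-! ### Period doubling -/

/-- The projection of `ℝ` onto `[0, 1]`. -/
noncomputable def clamp (t : ℝ) : ℝ := max 0 (min 1 t)

@[fun_prop]
theorem continuous_clamp : Continuous clamp := by unfold clamp; fun_prop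

theorem clamp_mem (t : ℝ) : clamp t ∈ Icc (0 : ℝ) 1 :=
  ⟨le_max_left _ _, max_le zero_le_one (min_le_left _ _)⟩

theorem clamp_of_mem {t : ℝ} (h : t ∈ Icc (0 : ℝ) 1) : clamp t = t := by
  rw [clamp, min_eq_right h.2, max_eq_right h.1]

theorem clamp_of_nonpos {t : ℝ} (h : t ≤ 0) : clamp t = 0 := by
  rw [clamp, min_eq_right (by linarith), max_eq_left h]

theorem clamp_of_one_le {t : ℝ} (h : 1 ≤ t) : clamp t = 1 := by
  rw [clamp, min_eq_left h, max_eq_right zero_le_one]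

/-- The doubling of a map of `[0, 1]`. -/
noncomputable def double (f : ℝ → ℝ) (y : ℝ) : ℝ :=
  (2 + f (clamp (3 * y))) / 3 * (1 - clamp (3 * y - 1)) + max 0 (y - 2 / 3)

section double

variable {f : ℝ → ℝ}

theorem double_continuous (hf : Continuous f) : Continuous (double f) := by
  unfold double; fun_prop

theorem double_left {x : ℝ} (hx : x ∈ Icc (0 : ℝ) 1) : double f (x / 3) = (2 + f x) / 3 := by
  have h1 := hx.1
  have h2 := hx.2
  rw [double, mul_div_cancel₀ _ three_ne_zero, clamp_of_mem hx, clamp_of_nonpos (by linarith),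
    max_eq_left (by linarith)]
  ring

theorem double_right {x : ℝ} (hx : x ∈ Icc (0 : ℝ) 1) : double f ((2 + x) / 3) = x / 3 := by
  have h1 := hx.1
  rw [double, clamp_of_one_le (t := 3 * ((2 + x) / 3) - 1) (by linarith),
    max_eq_right (by linarith)]
  ring

theorem double_middle {y : ℝ} (h1 : 1 / 3 ≤ y) (h2 : y ≤ 2 / 3) :
    double f y = (2 + f 1) / 3 * (2 - 3 * y) := by
  rw [double, clamp_of_one_le (by linarith), clamp_of_mem ⟨by linarith, by linarith⟩,
    max_eq_left (by linarith)]
  ring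

variable (hf : MapsTo f (Icc 0 1) (Icc 0 1))
include hf

theorem double_mapsTo : MapsTo (double f) (Icc 0 1) (Icc 0 1) := by
  intro y hy
  have h1 := hy.1
  have h2 := hy.2
  rcases le_total y (1 / 3) with h | h
  · have hx : 3 * y ∈ Icc (0 : ℝ) 1 := ⟨by linarith, by linarith⟩
    have := double_left (f := f) hx
    rw [mul_div_cancel_left₀ _ three_ne_zero] at this
    rw [this]
    have := hf hx
    constructor <;> linarith [this.1, this.2]
  · rcases le_total y (2 / 3) with h' | h'
    · rw [double_middle h h']
      have := hf (x := 1) (by simp)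
      constructor <;> nlinarith [this.1, this.2]
    · have hx : 3 * y - 2 ∈ Icc (0 : ℝ) 1 := ⟨by linarith, by linarith⟩
      have := double_right (f := f) hx
      rw [add_sub_cancel, mul_div_cancel_left₀ _ three_ne_zero] at this
      rw [this]
      constructor <;> linarith

/-- The outer thirds are exchanged. The second iterate on the left third is a copy of `f`, while odd
iterates of its points lie in the right third. -/
theorem double_minimalPeriod {x : ℝ} (hx : x ∈ Icc (0 : ℝ) 1) :
    minimalPeriod (double f) (x / 3) = 2 * minimalPeriod f x := by
  have hit : ∀ j, (double f)^[2 * j] (x / 3) = f^[j] x / 3 := fun j => by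
    rw [iterate_mul]
    refine iterate_conj (φ := fun x : ℝ => x / 3) hf (fun x hx => ?_) hx j
    simp only [iterate_succ_apply, iterate_zero, id]
    rw [double_left hx, double_right (hf hx)]
  refine Nat.dvd_antisymm ?_ ?_
  · apply IsPeriodicPt.minimalPeriod_dvd
    rw [IsPeriodicPt, IsFixedPt, hit, iterate_minimalPeriod]
  · have hret : (double f)^[minimalPeriod (double f) (x / 3)] (x / 3) = x / 3 :=
      iterate_minimalPeriod
    rcases Nat.even_or_odd' (minimalPeriod (double f) (x / 3)) with ⟨j, hj | hj⟩
    · rw [hj] at hret ⊢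
      rw [hit] at hret
      refine Nat.mul_dvd_mul_left _ (IsPeriodicPt.minimalPeriod_dvd ?_)
      change f^[j] x = x
      linarith
    · rw [hj, iterate_succ_apply', hit, double_left (hf.iterate j hx)] at hret
      have := (hf.iterate (j + 1) hx).1
      rw [iterate_succ_apply'] at this
      linarith [hx.2]

/-- On the middle third the map is affine of slope `-(2 + f 1)`, of modulus at least two, so a
periodic orbit that stays there is a fixed point. Any other orbit reaches the left third. -/
theorem double_periodSet {n : ℕ+} (h : n ∈ periodSet (double f)) :
    n = 1 ∨ ∃ m ∈ periodSet f, n = 2 * m := by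
  obtain ⟨y, hy, hn⟩ := h
  have hleft : ∀ i, (double f)^[i] y ≤ 1 / 3 → ∃ m ∈ periodSet f, n = 2 * m := by
    intro i hi
    have h1 := (double_mapsTo hf).iterate i hy
    have hx : 3 * (double f)^[i] y ∈ Icc (0 : ℝ) 1 := ⟨by linarith [h1.1], by linarith⟩
    have h2 := double_minimalPeriod hf hx
    rw [mul_div_cancel_left₀ _ three_ne_zero, minimalPeriod_iterate_of_pos hn i] at h2
    have h3 : 0 < minimalPeriod f (3 * (double f)^[i] y) := by have := n.pos; omega
    exact ⟨Nat.toPNat _ h3, ⟨_, hx, rfl⟩, PNat.eq h2⟩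
  by_cases hmid : ∀ i, 1 / 3 < (double f)^[i] y ∧ (double f)^[i] y < 2 / 3
  · left
    have hs := (hf (x := 1) (by simp)).1
    have hexp : ∀ i : ℕ, (double f)^[i + 1] y - (double f)^[i] y
        = (-(2 + f 1)) ^ i * (double f y - y) := by
      intro i
      induction i with
      | zero => simp
      | succ i ih =>
        rw [pow_succ', mul_assoc, ← ih]
        have e1 := double_middle (f := f) (hmid i).1.le (hmid i).2.le
        have e2 := double_middle (f := f) (hmid (i + 1)).1.le (hmid (i + 1)).2.le
        rw [iterate_succ_apply' _ (i + 1), e2, iterate_succ_apply' _ i, e1]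
        ring
    have hret : (double f)^[(n : ℕ)] y = y := by rw [← hn]; exact iterate_minimalPeriod
    have h1 := hexp n
    rw [iterate_succ_apply', hret] at h1
    refine eq_one_of_isFixedPt hn (sub_eq_zero.1 ?_)
    by_contra hne
    have h2 : (-(2 + f 1)) ^ (n : ℕ) = 1 := by
      apply mul_right_cancel₀ hne
      rw [← h1, one_mul]
    have h3 := congrArg abs h2
    rw [abs_pow, abs_neg, abs_one, abs_of_pos (by linarith)] at h3
    have h4 := one_lt_pow₀ (by linarith : 1 < 2 + f 1) n.ne_zero
    linarith
  · right
    push Not at hmid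
    obtain ⟨i, hi⟩ := hmid
    rcases le_or_gt ((double f)^[i] y) (1 / 3) with h | h
    · exact hleft i h
    · have h1 := (double_mapsTo hf).iterate i hy
      have hx : 3 * (double f)^[i] y - 2 ∈ Icc (0 : ℝ) 1 :=
        ⟨by linarith [hi h], by linarith [h1.2]⟩
      have h2 := double_right (f := f) hx
      rw [add_sub_cancel, mul_div_cancel_left₀ _ three_ne_zero] at h2
      refine hleft (i + 1) ?_
      rw [iterate_succ_apply', h2]
      linarith [hx.2]

end double

theorem exists_map_of_period (n : ℕ+) :
    ∃ f, Continuous f ∧ MapsTo f (Icc 0 1) (Icc 0 1) ∧ n ∈ periodSet f ∧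
      periodSet f ⊆ Sh (.num n) := by
  obtain ⟨a, p, hp, hn⟩ := exists_two_pow_mul_odd n
  induction a generalizing n with
  | zero =>
    rw [pow_zero, one_mul] at hn
    rcases eq_or_ne p 1 with rfl | hp1
    · obtain rfl : n = 1 := PNat.eq hn
      refine ⟨id, continuous_id, mapsTo_id _, ⟨0, by simp, by simp⟩, ?_⟩
      rintro m ⟨x, -, hm⟩
      rw [minimalPeriod_id] at hm
      obtain rfl : m = 1 := PNat.eq hm.symm
      exact one_mem_Sh _
    · exact exists_map_odd (hn ▸ hp) (by have := hp.pos; omega)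
  | succ a ih =>
    have h0 : 0 < 2 ^ a * p := Nat.mul_pos (by positivity) hp.pos
    obtain ⟨f, h1, h2, h3, h4⟩ := ih (Nat.toPNat _ h0) rfl
    obtain rfl : n = 2 * Nat.toPNat _ h0 := PNat.eq (by
      rw [hn, PNat.mul_coe]
      change 2 ^ (a + 1) * p = 2 * (2 ^ a * p)
      ring)
    refine ⟨double f, double_continuous h1, double_mapsTo h2, ?_, fun m hm => ?_⟩
    · obtain ⟨x, hx, h5⟩ := h3
      refine ⟨x / 3, ⟨by linarith [hx.1], by linarith [hx.2]⟩, ?_⟩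
      rw [double_minimalPeriod h2 hx, h5]
      rfl
    · rcases double_periodSet h2 hm with rfl | ⟨r, hr, rfl⟩
      · exact one_mem_Sh _
      · exact two_mul_mem_Sh (h4 hr)

end SigmaMaps

namespace SigmaMaps

open Filter Topology Set Function

/-! ### Maps with a prescribed set of periods -/

/-- The displacement of an extension of the map `f` of `[0, 1]`, put on `[1/3, 2/3]`, to a map which
is the identity off `[0, 1]`. -/
noncomputable def bump (f : ℝ → ℝ) (t : ℝ) : ℝ :=
  (f (clamp (3 * t - 1)) - clamp (3 * t - 1)) / 3 * max 0 (min 1 (min (3 * t) (3 - 3 * t)))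

section bump

variable {f : ℝ → ℝ}

theorem bump_continuous (hf : Continuous f) : Continuous (bump f) := by
  unfold bump; fun_prop

theorem bump_of_nonpos {t : ℝ} (h : t ≤ 0) : bump f t = 0 := by
  rw [bump, max_eq_left, mul_zero]
  exact (min_le_right _ _).trans ((min_le_left _ _).trans (by linarith))

theorem bump_of_one_le {t : ℝ} (h : 1 ≤ t) : bump f t = 0 := by
  rw [bump, max_eq_left, mul_zero]
  exact (min_le_right _ _).trans ((min_le_right _ _).trans (by linarith))

theorem bump_left {t : ℝ} (h0 : 0 ≤ t) (h1 : t ≤ 1 / 3) : bump f t = f 0 * t := by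
  rw [bump, clamp_of_nonpos (by linarith), min_eq_left (b := 3 - 3 * t) (by linarith),
    min_eq_right (by linarith), max_eq_right (by linarith)]
  ring

theorem bump_right {t : ℝ} (h0 : 2 / 3 ≤ t) (h1 : t ≤ 1) : bump f t = (f 1 - 1) * (1 - t) := by
  rw [bump, clamp_of_one_le (by linarith), min_eq_right (b := 3 - 3 * t) (by linarith),
    min_eq_right (by linarith), max_eq_right (by linarith)]
  ring

theorem bump_middle {x : ℝ} (hx : x ∈ Icc (0 : ℝ) 1) : bump f ((1 + x) / 3) = (f x - x) / 3 := by
  have h1 := hx.1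
  have h2 := hx.2
  rw [bump, show 3 * ((1 + x) / 3) - 1 = x by ring, clamp_of_mem hx,
    min_eq_left (le_min (by linarith) (by linarith)), max_eq_right zero_le_one, mul_one]

variable (hf : MapsTo f (Icc 0 1) (Icc 0 1))
include hf

theorem abs_bump_le (t : ℝ) : |bump f t| ≤ 1 := by
  have h1 := hf (clamp_mem (3 * t - 1))
  have h2 := clamp_mem (3 * t - 1)
  rw [bump, abs_mul]
  have h3 : |max 0 (min 1 (min (3 * t) (3 - 3 * t)))| ≤ 1 := by
    rw [abs_of_nonneg (le_max_left _ _)]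
    exact max_le zero_le_one (min_le_left _ _)
  have h4 : |(f (clamp (3 * t - 1)) - clamp (3 * t - 1)) / 3| ≤ 1 := by
    rw [abs_le]
    constructor <;> linarith [h1.1, h1.2, h2.1, h2.2]
  calc _ ≤ (1 : ℝ) * 1 := mul_le_mul h4 h3 (abs_nonneg _) zero_le_one
    _ = 1 := one_mul 1

theorem add_bump_left {t : ℝ} (h0 : 0 ≤ t) (h1 : t ≤ 1 / 3) :
    t ≤ t + bump f t ∧ t + bump f t ≤ 2 / 3 := by
  have := hf (x := 0) (by simp)
  rw [bump_left h0 h1]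
  constructor <;> nlinarith [this.1, this.2]

theorem add_bump_right {t : ℝ} (h0 : 2 / 3 ≤ t) (h1 : t ≤ 1) :
    t + bump f t ≤ t ∧ 1 / 3 ≤ t + bump f t := by
  have := hf (x := 1) (by simp)
  rw [bump_right h0 h1]
  constructor <;> nlinarith [this.1, this.2]

theorem add_bump_middle {t : ℝ} (h0 : 1 / 3 ≤ t) (h1 : t ≤ 2 / 3) :
    t + bump f t ∈ Icc (1 / 3 : ℝ) (2 / 3) := by
  have hx : 3 * t - 1 ∈ Icc (0 : ℝ) 1 := ⟨by linarith, by linarith⟩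
  have h2 := bump_middle (f := f) hx
  rw [add_sub_cancel, mul_div_cancel_left₀ _ three_ne_zero] at h2
  have h3 := hf hx
  rw [h2]
  constructor <;> linarith [h3.1, h3.2]

theorem add_bump_mapsTo : MapsTo (fun t => t + bump f t) (Icc 0 1) (Icc 0 1) := by
  intro t ht
  rcases le_total t (1 / 3) with h | h
  · have := add_bump_left hf ht.1 h
    exact ⟨ht.1.trans this.1, this.2.trans (by norm_num)⟩
  · rcases le_total t (2 / 3) with h' | h'
    · have := add_bump_middle hf h h'
      exact ⟨(by norm_num : (0 : ℝ) ≤ 1 / 3).trans this.1, this.2.trans (by norm_num)⟩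
    · have := add_bump_right hf h' ht.2
      exact ⟨(by norm_num : (0 : ℝ) ≤ 1 / 3).trans this.2, this.1.trans ht.2⟩

theorem add_bump_minimalPeriod {x : ℝ} (hx : x ∈ Icc (0 : ℝ) 1) :
    minimalPeriod (fun t => t + bump f t) ((1 + x) / 3) = minimalPeriod f x := by
  refine minimalPeriod_conj (φ := fun x : ℝ => (1 + x) / 3) hf (fun x y h => ?_)
    (fun x hx => ?_) hx
  · simpa using h
  · rw [bump_middle hx]
    ring

theorem periodSet_subset_add_bump : periodSet f ⊆ periodSet fun t => t + bump f t := by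
  rintro n ⟨x, hx, hn⟩
  exact ⟨(1 + x) / 3, ⟨by linarith [hx.1], by linarith [hx.2]⟩, by
    rw [add_bump_minimalPeriod hf hx, hn]⟩

/-- On either side of `[1/3, 2/3]` points move weakly towards the middle. An orbit avoiding the
middle stays on one side and is monotone, so it is fixed if periodic. -/
theorem periodSet_add_bump {n : ℕ+} (hn : n ∈ periodSet fun t => t + bump f t) :
    n = 1 ∨ n ∈ periodSet f := by
  obtain ⟨t, ht, hn⟩ := hn
  set E := fun t => t + bump f t with hE
  have hinv : ∀ i, E^[i] t ∈ Icc (0 : ℝ) 1 := fun i => (add_bump_mapsTo hf).iterate i ht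
  by_cases hmid : ∃ i, 1 / 3 ≤ E^[i] t ∧ E^[i] t ≤ 2 / 3
  · right
    obtain ⟨i, h1, h2⟩ := hmid
    have hx : 3 * E^[i] t - 1 ∈ Icc (0 : ℝ) 1 := ⟨by linarith, by linarith⟩
    have h3 := add_bump_minimalPeriod hf hx
    rw [add_sub_cancel, mul_div_cancel_left₀ _ three_ne_zero] at h3
    exact ⟨_, hx, by rw [← h3]; exact minimalPeriod_iterate_of_pos hn i⟩
  · left
    push Not at hmid
    rcases lt_or_ge t (1 / 3) with h | h
    · have hl : ∀ i, E^[i] t < 1 / 3 := fun i => by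
        induction i with
        | zero => exact h
        | succ i ih =>
          by_contra! hcon
          have h1 := (add_bump_left hf (hinv i).1 ih.le).2
          have h2 := hmid (i + 1) hcon
          rw [iterate_succ_apply'] at h2
          exact absurd h2 (not_lt.2 h1)
      exact eq_one_of_le_succ hn fun i => (add_bump_left hf (hinv i).1 (hl i).le).1
    · have hl : ∀ i, 2 / 3 < E^[i] t := fun i => by
        induction i with
        | zero => exact hmid 0 h
        | succ i ih =>
          refine hmid (i + 1) ?_
          rw [iterate_succ_apply']
          exact (add_bump_right hf ih.le (hinv i).2).2
      exact eq_one_of_succ_le hn fun i => (add_bump_right hf (hl i).le (hinv i).2).1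

end bump

/-- Copies of the maps `t ↦ t + bump (f k) t` on the intervals `[2 ^ (-k-1), 2 ^ (-k)]`. -/
noncomputable def glue (f : ℕ → ℝ → ℝ) (x : ℝ) : ℝ :=
  x + ∑' k, (1 / 2) ^ (k + 1) * bump (f k) (2 ^ (k + 1) * x - 1)

theorem glue_continuous {f : ℕ → ℝ → ℝ} (hf : ∀ k, Continuous (f k))
    (hm : ∀ k, MapsTo (f k) (Icc 0 1) (Icc 0 1)) : Continuous (glue f) := by
  refine continuous_id.add (continuous_tsum (u := fun k => (1 / 2 : ℝ) ^ (k + 1)) (fun k => ?_)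
    ?_ fun k x => ?_)
  · have := bump_continuous (hf k)
    fun_prop
  · exact (summable_nat_add_iff 1).2 summable_geometric_two
  · rw [Real.norm_eq_abs, abs_mul, abs_of_pos (by positivity)]
    exact mul_le_of_le_one_right (by positivity) (abs_bump_le (hm k) _)

theorem glue_of_nonpos {f : ℕ → ℝ → ℝ} {x : ℝ} (hx : x ≤ 0) : glue f x = x := by
  have : ∀ k, (1 / 2 : ℝ) ^ (k + 1) * bump (f k) (2 ^ (k + 1) * x - 1) = 0 := fun k => by
    have h1 : (2 : ℝ) ^ (k + 1) * x ≤ 0 := mul_nonpos_of_nonneg_of_nonpos (by positivity) hx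
    rw [bump_of_nonpos (by linarith), mul_zero]
  simp only [glue, this, tsum_zero, add_zero]

theorem glue_of_one_le {f : ℕ → ℝ → ℝ} {x : ℝ} (hx : 1 ≤ x) : glue f x = x := by
  have : ∀ k, (1 / 2 : ℝ) ^ (k + 1) * bump (f k) (2 ^ (k + 1) * x - 1) = 0 := fun k => by
    have h1 : (2 : ℝ) ≤ 2 ^ (k + 1) := le_self_pow₀ (by norm_num) (by omega)
    rw [bump_of_one_le (by nlinarith), mul_zero]
  simp only [glue, this, tsum_zero, add_zero]

theorem glue_of_mem {f : ℕ → ℝ → ℝ} (k : ℕ) {t : ℝ} (ht : t ∈ Icc (0 : ℝ) 1) :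
    glue f ((1 + t) / 2 ^ (k + 1)) = (1 + (t + bump (f k) t)) / 2 ^ (k + 1) := by
  have h2 : ∀ n : ℕ, (0 : ℝ) < 2 ^ n := fun n => by positivity
  rw [glue, tsum_eq_single k]
  · rw [mul_div_cancel₀ _ (h2 _).ne', add_sub_cancel_left, div_pow, one_pow]
    field_simp
    ring
  · intro j hj
    rcases lt_or_gt_of_ne hj with h | h
    · rw [bump_of_nonpos, mul_zero]
      have h3 : (2 : ℝ) ^ (j + 1) * 2 ≤ 2 ^ (k + 1) := by
        rw [← pow_succ]
        exact pow_le_pow_right₀ (by norm_num) (by omega)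
      rw [sub_nonpos, ← mul_div_assoc, div_le_one (h2 _)]
      nlinarith [h2 (j + 1), ht.2]
    · rw [bump_of_one_le, mul_zero]
      have h3 : (2 : ℝ) ^ (k + 1) * 2 ≤ 2 ^ (j + 1) := by
        rw [← pow_succ]
        exact pow_le_pow_right₀ (by norm_num) (by omega)
      rw [le_sub_iff_add_le, ← mul_div_assoc, le_div_iff₀ (h2 _)]
      nlinarith [h2 (j + 1), h2 (k + 1), ht.1]

theorem exists_eq_div_two_pow {x : ℝ} (h0 : 0 < x) (h1 : x ≤ 1) :
    ∃ k : ℕ, ∃ t ∈ Icc (0 : ℝ) 1, x = (1 + t) / 2 ^ (k + 1) := by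
  obtain ⟨k, hk1, hk2⟩ := exists_nat_pow_near_of_lt_one h0 h1 (by norm_num : (0 : ℝ) < 1 / 2)
    (by norm_num)
  have hp : (0 : ℝ) < 2 ^ (k + 1) := by positivity
  rw [div_pow, one_pow, div_lt_iff₀ hp] at hk1
  rw [div_pow, one_pow, le_div_iff₀ (by positivity)] at hk2
  refine ⟨k, x * 2 ^ (k + 1) - 1, ⟨by linarith, ?_⟩, ?_⟩
  · rw [pow_succ]; linarith
  · field_simp; ring

theorem glue_minimalPeriod {f : ℕ → ℝ → ℝ} (hm : ∀ k, MapsTo (f k) (Icc 0 1) (Icc 0 1)) (k : ℕ)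
    {t : ℝ} (ht : t ∈ Icc (0 : ℝ) 1) :
    minimalPeriod (glue f) ((1 + t) / 2 ^ (k + 1))
      = minimalPeriod (fun t => t + bump (f k) t) t := by
  refine minimalPeriod_conj (φ := fun t : ℝ => (1 + t) / 2 ^ (k + 1)) (add_bump_mapsTo (hm k))
    (fun x y h => ?_) (fun x hx => glue_of_mem k hx) ht
  have h2 : (2 : ℝ) ^ (k + 1) ≠ 0 := by positivity
  simpa [div_left_inj' h2] using h

theorem div_two_pow_mem (k : ℕ) {t : ℝ} (ht : t ∈ Icc (0 : ℝ) 1) :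
    (1 + t) / 2 ^ (k + 1) ∈ Icc (0 : ℝ) 1 := by
  have h1 : (2 : ℝ) ≤ 2 ^ (k + 1) := le_self_pow₀ (by norm_num) (by omega)
  refine ⟨div_nonneg (by linarith [ht.1]) (by positivity), ?_⟩
  rw [div_le_one (by positivity)]
  linarith [ht.2]

/-- Every set of positive integers closed under the Sharkovsky ordering is the set of periods of an
map of `[0, 1]` that extends by the identity to `ℝ`. -/
theorem exists_map_of_periodSet (P : Set ℕ+) (h1 : 1 ∈ P) (hP : ∀ k ∈ P, Sh (.num k) ⊆ P) :
    ∃ g, Continuous g ∧ (∀ x, x ≤ 0 ∨ 1 ≤ x → g x = x) ∧ MapsTo g (Icc 0 1) (Icc 0 1) ∧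
      periodSet g = P := by
  classical
  choose F hF1 hF2 hF3 hF4 using exists_map_of_period
  -- Enumerates `P`, with `1` in place of the missing numbers. One copy per element is used because
  -- `P` may have no greatest element, as for `2^∞`.
  let p : ℕ → ℕ+ := fun k => if k.succPNat ∈ P then k.succPNat else 1
  have hp : ∀ k, p k ∈ P := fun k => by
    simp only [p]; split_ifs with h; exacts [h, h1]
  have hm : ∀ k, MapsTo (F (p k)) (Icc 0 1) (Icc 0 1) := fun k => hF2 _
  refine ⟨glue fun k => F (p k), glue_continuous (fun k => hF1 _) hm, ?_, ?_, ?_⟩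
  · rintro x (h | h)
    exacts [glue_of_nonpos h, glue_of_one_le h]
  · rintro x ⟨hx0, hx1⟩
    rcases hx0.eq_or_lt with rfl | hx0
    · rw [glue_of_nonpos le_rfl]; simp
    · obtain ⟨k, t, ht, rfl⟩ := exists_eq_div_two_pow hx0 hx1
      rw [glue_of_mem k ht]
      exact div_two_pow_mem k (add_bump_mapsTo (hm k) ht)
  · ext n
    constructor
    · rintro ⟨x, ⟨hx0, hx1⟩, hn⟩
      rcases hx0.eq_or_lt with rfl | hx0
      · rw [eq_one_of_isFixedPt hn (glue_of_nonpos le_rfl)]; exact h1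
      · obtain ⟨k, t, ht, rfl⟩ := exists_eq_div_two_pow hx0 hx1
        rw [glue_minimalPeriod hm k ht] at hn
        rcases periodSet_add_bump (hm k) ⟨t, ht, hn⟩ with rfl | h
        · exact h1
        · exact hP _ (hp k) (hF4 _ h)
    · intro hn
      have hpn : p n.natPred = n := by simp [p, hn]
      obtain ⟨t, ht, h⟩ := periodSet_subset_add_bump (hm n.natPred)
        (show n ∈ periodSet (F (p n.natPred)) by rw [hpn]; exact hF3 n)
      exact ⟨_, div_two_pow_mem n.natPred ht, by rw [glue_minimalPeriod hm _ ht, h]⟩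

end SigmaMaps

namespace SigmaMaps

open Filter Topology Set Function

/-! ### Lower ends of the rotation interval, and the arcs -/

/-- `f` has the rotation number `c` as smallest rotation number, and the periods modulo one at `c`
are those of `Λ(c, P)`. -/
structure LowerEnd (f : ℝ → ℝ) (c : ℝ) (P : Set ℕ+) : Prop where
  exists_rotNum : ∃ x, RotNum f x c
  le : ∀ x ρ, RotNum f x ρ → c ≤ ρ
  mem_of_isPer : ∀ x n, IsPer f x n → RotNum f x c → n ∈ Lam c P
  exists_isPer : ∀ n ∈ Lam c P, ∃ x, IsPer f x n

/-- The arcs of length `1 / (4 m)` centered at the points of `(ℤ + 1 / 4) / m`. -/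
def arcs (m : ℕ) : Set ℝ := {x | Int.fract (m * x) ∈ Icc (1 / 8 : ℝ) (3 / 8)}

theorem mem_arcs_of {m : ℕ} {x : ℝ} {j : ℤ} (h : m * x - j ∈ Icc (1 / 8 : ℝ) (3 / 8)) :
    x ∈ arcs m := by
  have : ⌊m * x⌋ = j := Int.floor_eq_iff.2 ⟨by linarith [h.1], by linarith [h.2]⟩
  change m * x - ⌊m * x⌋ ∈ Icc (1 / 8 : ℝ) (3 / 8)
  rwa [this]

/-- A piecewise affine function on the circle, nonpositive exactly on `[1/8, 3/8]` and at least one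
on `[5/8, 7/8]`. -/
noncomputable def profile (t : ℝ) : ℝ :=
  min (max (1 / 2 - 4 * t) (4 * t - 3 / 2)) (9 / 2 - 4 * t)

theorem profile_fract_continuous : Continuous fun y => profile (Int.fract y) := by
  refine ContinuousOn.comp_fract'' (f := profile) ?_ ?_
  · unfold profile; fun_prop
  · norm_num [profile]

theorem profile_nonpos_iff {t : ℝ} (h1 : t < 1) : profile t ≤ 0 ↔ t ∈ Icc (1 / 8 : ℝ) (3 / 8) := by
  rw [profile, min_le_iff, max_le_iff, mem_Icc]
  constructor
  · rintro (h | h)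
    · constructor <;> linarith [h.1, h.2]
    · linarith
  · intro h
    exact Or.inl ⟨by linarith [h.1], by linarith [h.2]⟩

theorem isClosed_arcs (m : ℕ) : IsClosed (arcs m) := by
  have : arcs m = (fun x : ℝ => profile (Int.fract (m * x))) ⁻¹' Iic 0 := by
    ext x
    exact (profile_nonpos_iff (Int.fract_lt_one _)).symm
  rw [this]
  exact isClosed_Iic.preimage (profile_fract_continuous.comp (continuous_const_mul _))

theorem add_int_mem_arcs {m : ℕ} {x : ℝ} (h : x ∈ arcs m) (k : ℤ) : x + k ∈ arcs m := by
  have : (m : ℝ) * (x + k) = m * x + (m * k : ℤ) := by push_cast; ring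
  change Int.fract (m * (x + k)) ∈ Icc (1 / 8 : ℝ) (3 / 8)
  rw [this, Int.fract_add_intCast]
  exact h

theorem mem_Lam_iff {k : ℤ} {n : ℕ+} (hkn : IsCoprime k (n : ℤ)) {P : Set ℕ+} {N : ℕ+} :
    N ∈ Lam ((k : ℝ) / n) P ↔ ∃ q ∈ P, N = n * q := by
  constructor
  · rintro ⟨k', n', hk', h, q, hq, rfl⟩
    obtain ⟨a, -, ha, -⟩ := dvd_of_ratio n.pos hkn n'.pos h.symm
    obtain ⟨b, -, hb, -⟩ := dvd_of_ratio n'.pos hk' n.pos h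
    have : n = n' := PNat.eq (Nat.dvd_antisymm (Dvd.intro _ ha.symm) (Dvd.intro _ hb.symm))
    exact ⟨q, hq, by rw [this]⟩
  · rintro ⟨q, hq, rfl⟩
    exact ⟨k, n, hkn, rfl, q, hq, rfl⟩

theorem IsLift.returns_iterate_iff {f : ℝ → ℝ} (hf : IsLift f) {x : ℝ} {N : ℕ+}
    (h : Returns f x N) (i j : ℕ) : Returns f (f^[i] x) j ↔ Returns f x j := by
  have key : ∀ {y : ℝ} (i j : ℕ), Returns f y j → Returns f (f^[i] y) j := by
    rintro y i j ⟨K, hK⟩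
    exact ⟨K, by rw [← iterate_add_apply, add_comm, iterate_add_apply, hK, hf.iterate_add_int]⟩
  refine ⟨fun h1 => ?_, key i j⟩
  obtain ⟨K, hK⟩ := h
  obtain ⟨L, hL⟩ := key (N * i - i) j h1
  have h2 : f^[(N : ℕ) * i - i] (f^[i] x) = x + (K * i : ℤ) := by
    rw [← iterate_add_apply, Nat.sub_add_cancel (Nat.le_mul_of_pos_left _ N.pos),
      hf.iterate_mul N K, iterate_fixed (by simp [hK])]
  rw [h2, hf.iterate_add_int] at hL
  exact ⟨L, by linarith⟩

theorem IsLift.isPer_iterate {f : ℝ → ℝ} (hf : IsLift f) {x : ℝ} {N : ℕ+} (h : IsPer f x N)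
    (i : ℕ) : IsPer f (f^[i] x) N := by
  simpa only [IsPer, hf.returns_iterate_iff h.1] using h

theorem IsLift.isPer_add_int {f : ℝ → ℝ} (hf : IsLift f) {x : ℝ} {N : ℕ+} (h : IsPer f x N)
    (k : ℤ) : IsPer f (x + k) N := by
  have : ∀ j, Returns f (x + k) j ↔ Returns f x j := fun j => by
    refine exists_congr fun K => ?_
    rw [hf.iterate_add_int]
    constructor <;> intro h <;> linarith
  simpa only [IsPer, this] using h

theorem IsLift.rotNum_iterate {f : ℝ → ℝ} (hf : IsLift f) {x c : ℝ} {N : ℕ+} (h : IsPer f x N)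
    (hc : RotNum f x c) (i : ℕ) : RotNum f (f^[i] x) c := by
  obtain ⟨K, hK⟩ := h.1
  have h1 : f^[(N : ℕ)] (f^[i] x) = f^[i] x + K := by
    rw [← iterate_add_apply, add_comm, iterate_add_apply, hK, hf.iterate_add_int]
  rw [tendsto_nhds_unique hc (hf.rotNum_of_returns N.pos hK)]
  exact hf.rotNum_of_returns N.pos h1

/-! ## Rational end points -/

/-- The rotation by `c`, followed by a small copy of `g` on the first of the arcs. -/
noncomputable def rotBump (g : ℝ → ℝ) (c : ℝ) (m : ℕ) (x : ℝ) : ℝ :=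
  x + c + (g (4 * m * Int.fract x - 1 / 2) - (4 * m * Int.fract x - 1 / 2)) / (4 * m)

section rational

variable {g : ℝ → ℝ} {c : ℝ} {m : ℕ}

theorem rotBump_isLift (hg : Continuous g) (hid : ∀ x, x ≤ 0 ∨ 1 ≤ x → g x = x) (hm : 0 < m) :
    IsLift (rotBump g c m) := by
  have hm' : (1 : ℝ) ≤ m := by exact_mod_cast hm
  constructor
  · have : Continuous fun x : ℝ => (fun t => g (4 * m * t - 1 / 2) - (4 * m * t - 1 / 2))
        (Int.fract x) := by
      refine ContinuousOn.comp_fract'' (f := fun t : ℝ => g (4 * m * t - 1 / 2) -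
        (4 * m * t - 1 / 2)) (by fun_prop) ?_
      rw [hid _ (Or.inl (by linarith)), hid _ (Or.inr (by linarith))]
      ring
    unfold rotBump
    fun_prop
  · intro x
    simp only [rotBump, Int.fract_add_one]
    ring

theorem rotBump_of_fixed {x : ℝ} (h : g (4 * m * Int.fract x - 1 / 2) = 4 * m * Int.fract x - 1 / 2) :
    rotBump g c m x = x + c := by
  rw [rotBump, h, sub_self, zero_div, add_zero]

theorem abs_rotBump_sub_le (hid : ∀ x, x ≤ 0 ∨ 1 ≤ x → g x = x)
    (hmaps : MapsTo g (Icc 0 1) (Icc 0 1)) (hm : 0 < m) (x : ℝ) :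
    |rotBump g c m x - x - c| ≤ 1 / m := by
  have hm' : (0 : ℝ) < m := by exact_mod_cast hm
  have key : ∀ s, |g s - s| ≤ 1 := fun s => by
    by_cases hs : s ≤ 0 ∨ 1 ≤ s
    · rw [hid s hs]; simp
    · push Not at hs
      have := hmaps (x := s) ⟨hs.1.le, hs.2.le⟩
      rw [abs_le]
      constructor <;> linarith [this.1, this.2]
  rw [rotBump, show ∀ e : ℝ, x + c + e - x - c = e by intro e; ring, abs_div,
    abs_of_pos (by positivity : (0 : ℝ) < 4 * m), div_le_div_iff₀ (by positivity) hm']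
  nlinarith [key (4 * m * Int.fract x - 1 / 2)]

variable {k : ℤ} {n : ℕ+} (hkn : IsCoprime k (n : ℤ)) (hc : c = (k : ℝ) / n) {r : ℕ}
  (hmr : m = n * r) (hm : 0 < m) (hid : ∀ x, x ≤ 0 ∨ 1 ≤ x → g x = x)
  (hmaps : MapsTo g (Icc 0 1) (Icc 0 1)) {F : ℝ → ℝ} (hF : IsLift F)
  (hge : ∀ x, rotBump g c m x ≤ F x) (heq : ∀ x ∈ arcs m, F x = rotBump g c m x)

include hc hmr in
theorem mul_rot : m * c = (k * r : ℤ) := by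
  have : ((n : ℕ) : ℝ) ≠ 0 := by positivity
  rw [hc, hmr]
  push_cast
  field_simp

/-- Among all the arcs, `rotBump` differs from the rotation only on the integer translates of the
first one, those whose index is divisible by `m`. -/
theorem eq_floor_of_mem {x : ℝ} {j : ℤ} (hj : m * x - j ∈ Icc (1 / 8 : ℝ) (3 / 8))
    (h0 : 0 ≤ 4 * m * Int.fract x - 1 / 2) (h1 : 4 * m * Int.fract x - 1 / 2 ≤ 1) :
    j = m * ⌊x⌋ := by
  have e : (m : ℝ) * Int.fract x = m * x - m * ⌊x⌋ := by rw [Int.fract]; ring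
  have h2 : |((j - m * ⌊x⌋ : ℤ) : ℝ)| < 1 := by
    push_cast
    rw [abs_lt]
    constructor <;> linarith [hj.1, hj.2]
  have h3 : |j - m * ⌊x⌋| < 1 := by exact_mod_cast h2
  linarith [Int.abs_lt_one_iff.1 h3]

include hid hge in
theorem add_le_of_not_mem {x : ℝ}
    (hs : 4 * m * Int.fract x - 1 / 2 ≤ 0 ∨ 1 ≤ 4 * m * Int.fract x - 1 / 2) : x + c ≤ F x := by
  rw [← rotBump_of_fixed (hid _ hs)]
  exact hge x

include hid hmaps hm in
theorem mul_rotBump (x : ℝ) : m * rotBump g c m x = m * x + m * c ∨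
    m * x - (m * ⌊x⌋ : ℤ) ∈ Ioo (1 / 8 : ℝ) (3 / 8) ∧
      m * rotBump g c m x - m * c - (m * ⌊x⌋ : ℤ) ∈ Icc (1 / 8 : ℝ) (3 / 8) := by
  have hm' : (m : ℝ) ≠ 0 := by positivity
  by_cases hs : 4 * m * Int.fract x - 1 / 2 ≤ 0 ∨ 1 ≤ 4 * m * Int.fract x - 1 / 2
  · left
    rw [rotBump_of_fixed (hid _ hs), mul_add]
  · right
    push Not at hs
    have hs' : 4 * m * Int.fract x - 1 / 2 ∈ Icc (0 : ℝ) 1 := ⟨hs.1.le, hs.2.le⟩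
    have hg := hmaps hs'
    have e : (m : ℝ) * Int.fract x = m * x - (m * ⌊x⌋ : ℤ) := by rw [Int.fract]; push_cast; ring
    refine ⟨⟨by linarith, by linarith⟩, ?_⟩
    set s := 4 * m * Int.fract x - 1 / 2 with hsdef
    have e2 : m * rotBump g c m x = m * x + m * c + (g s - s) / 4 := by
      rw [rotBump, ← hsdef]; field_simp
    rw [e2]
    constructor <;> linarith [hg.1, hg.2]

include hid hmaps hm in
-- The left end points of the arcs are barriers: `g` maps `[0, 1]` to itself, so the bump pushes
-- nothing across them. When `m * c` is an integer, the rotation permutes the barriers, and the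
-- estimate can be iterated.
theorem rotBump_ge_of_le {x : ℝ} {j : ℤ} (hj : j + 1 / 8 ≤ m * x) :
    j + 1 / 8 + m * c ≤ m * rotBump g c m x := by
  rcases mul_rotBump (c := c) hm hid hmaps x with h | ⟨h1, h2⟩
  · linarith
  · have h3 : (j : ℝ) < (m * ⌊x⌋ + 1 : ℤ) := by rw [Int.cast_add]; push_cast at *; linarith [h1.2]
    have h4 : (j : ℝ) ≤ (m * ⌊x⌋ : ℤ) := by exact_mod_cast Int.lt_add_one_iff.1 (Int.cast_lt.1 h3)
    linarith [h2.1]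

include hid hmaps hm in
theorem rotBump_le_of_le {x : ℝ} {j : ℤ} (hj : m * x ≤ j + 1 / 8) :
    m * rotBump g c m x ≤ j + 1 / 8 + m * c := by
  rcases mul_rotBump (c := c) hm hid hmaps x with h | ⟨h1, h2⟩
  · linarith
  · have h3 : ((m * ⌊x⌋ : ℤ) : ℝ) < j := by linarith [h1.1]
    have h4 : ((m * ⌊x⌋ + 1 : ℤ) : ℝ) ≤ j := by exact_mod_cast Int.cast_lt.1 h3
    rw [Int.cast_add] at h4
    push_cast at *
    linarith [h2.2]

include hc hmr hm hid hmaps hge in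
theorem rotBump_iterate_ge (x : ℝ) (i : ℕ) : i * c - 2 / m ≤ F^[i] x - x := by
  have hmc := mul_rot hc hmr
  have hm' : (0 : ℝ) < m := by exact_mod_cast hm
  have h0 : (⌊m * x - 1 / 8⌋ : ℝ) + 1 / 8 ≤ m * x := by linarith [Int.floor_le (m * x - 1 / 8)]
  have h1 := Int.lt_floor_add_one (m * x - 1 / 8)
  set j := ⌊m * x - 1 / 8⌋
  have key : ((j + i * (k * r) : ℤ) : ℝ) + 1 / 8 ≤ m * F^[i] x := by
    induction i with
    | zero => simpa using h0
    | succ i ih =>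
      have h2 := rotBump_ge_of_le (c := c) hm hid hmaps ih
      have h3 := mul_le_mul_of_nonneg_left (hge (F^[i] x)) hm'.le
      rw [iterate_succ_apply']
      rw [hmc] at h2
      push_cast at h2 ⊢
      linarith
  have h3 : (m : ℝ) * (i * c - 2 / m) = (i * (k * r) : ℤ) - 2 := by
    rw [mul_sub, mul_left_comm, hmc]; push_cast; field_simp
  refine le_of_mul_le_mul_left ?_ hm'
  rw [h3, mul_sub]
  rw [Int.cast_add] at key
  linarith

include hc hmr hm hid hmaps in
theorem rotBump_iterate_le (x : ℝ) (i : ℕ) : (rotBump g c m)^[i] x - x ≤ i * c + 2 / m := by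
  have hmc := mul_rot hc hmr
  have hm' : (0 : ℝ) < m := by exact_mod_cast hm
  have h0 : m * x ≤ (⌈m * x - 1 / 8⌉ : ℝ) + 1 / 8 := by linarith [Int.le_ceil (m * x - 1 / 8)]
  have h1 := Int.ceil_lt_add_one (m * x - 1 / 8)
  set j := ⌈m * x - 1 / 8⌉
  have key : m * (rotBump g c m)^[i] x ≤ ((j + i * (k * r) : ℤ) : ℝ) + 1 / 8 := by
    induction i with
    | zero => simpa using h0
    | succ i ih =>
      have h2 := rotBump_le_of_le (c := c) hm hid hmaps ih
      rw [iterate_succ_apply']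
      rw [hmc] at h2
      push_cast at h2 ⊢
      linarith
  have h3 : (m : ℝ) * (i * c + 2 / m) = (i * (k * r) : ℤ) + 2 := by
    rw [mul_add, mul_left_comm, hmc]; push_cast; field_simp
  refine le_of_mul_le_mul_left ?_ hm'
  rw [h3, mul_sub]
  rw [Int.cast_add] at key
  linarith

include hkn hc hmr hm hid hmaps heq in
-- The first step applies `g` once and rotates. During the next `n - 1` steps the point visits other
-- arcs modulo one, because `k` and `n` are coprime, and there the map is the pure rotation by `c`.
theorem rotBump_first_return {t : ℝ} (ht : t ∈ Icc (0 : ℝ) 1) :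
    F^[(n : ℕ)] ((1 / 8 + t / 4) / m) - k = (1 / 8 + g t / 4) / m := by
  have hmc := mul_rot hc hmr
  have hm' : (1 : ℝ) ≤ m := by exact_mod_cast hm
  have hm0 : (m : ℝ) ≠ 0 := by positivity
  have hn0 : ((n : ℕ) : ℝ) ≠ 0 := by positivity
  have hgt := hmaps ht
  have key : ∀ i : ℕ, i < n →
      F^[i + 1] ((1 / 8 + t / 4) / m) = (1 / 8 + g t / 4) / m + (i + 1) * c := by
    intro i
    induction i with
    | zero =>
      intro _
      have hx : m * ((1 / 8 + t / 4) / m) - (0 : ℤ) ∈ Icc (1 / 8 : ℝ) (3 / 8) := by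
        rw [mul_div_cancel₀ _ hm0]
        constructor <;> push_cast <;> linarith [ht.1, ht.2]
      have hfr : Int.fract ((1 / 8 + t / 4) / m) = (1 / 8 + t / 4) / m := by
        rw [Int.fract_eq_self]
        refine ⟨div_nonneg (by linarith [ht.1]) (by linarith), ?_⟩
        rw [div_lt_one (by linarith)]
        linarith [ht.2]
      have hs : 4 * m * ((1 / 8 + t / 4) / m) - 1 / 2 = t := by field_simp; ring
      rw [zero_add, iterate_one, heq _ (mem_arcs_of hx), rotBump, hfr, hs]
      push_cast
      field_simp
      ring
    | succ i ih =>
      intro hi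
      rw [iterate_succ_apply', ih (by omega)]
      set y := (1 / 8 + g t / 4) / m + (i + 1) * c with hy
      have hmy : m * y - ((i + 1 : ℕ) * (k * r) : ℤ) = 1 / 8 + g t / 4 := by
        rw [hy, mul_add, mul_div_cancel₀ _ hm0, ← mul_assoc, mul_comm (m : ℝ), mul_assoc, hmc]
        push_cast; ring
      have hx : m * y - ((i + 1 : ℕ) * (k * r) : ℤ) ∈ Icc (1 / 8 : ℝ) (3 / 8) := by
        rw [hmy]
        constructor <;> linarith [hgt.1, hgt.2]
      have hs : 4 * m * Int.fract y - 1 / 2 ≤ 0 ∨ 1 ≤ 4 * m * Int.fract y - 1 / 2 := by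
        by_contra hs
        push Not at hs
        have h1 := eq_floor_of_mem hx hs.1.le hs.2.le
        have hr : (r : ℤ) ≠ 0 := by
          rintro h
          have : r = 0 := by exact_mod_cast h
          rw [this, mul_zero] at hmr
          omega
        have h2 : ((i + 1 : ℕ) : ℤ) * k = n * ⌊y⌋ := by
          apply mul_right_cancel₀ hr
          rw [hmr] at h1
          push_cast at h1 ⊢
          linarith
        have h3 : (n : ℤ) ∣ (i + 1 : ℕ) := hkn.symm.dvd_of_dvd_mul_right (Dvd.intro _ h2.symm)
        have h4 := Nat.le_of_dvd (Nat.succ_pos i) (Int.natCast_dvd_natCast.1 h3)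
        omega
      rw [heq _ (mem_arcs_of hx), rotBump_of_fixed (hid _ hs), hy]
      push_cast
      ring
  obtain ⟨i, hi⟩ : ∃ i, (n : ℕ) = i + 1 := ⟨_, (Nat.succ_pred_eq_of_pos n.pos).symm⟩
  have h1 := key i (by omega)
  have h2 : ((i : ℝ) + 1) * c = k := by
    have : ((n : ℕ) : ℝ) = i + 1 := by exact_mod_cast hi
    rw [← this, hc]
    field_simp
  rw [hi, h1, h2]
  ring

include hkn hc hmr hm hid hmaps heq in
theorem rotBump_minimalPeriod {t : ℝ} (ht : t ∈ Icc (0 : ℝ) 1) :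
    minimalPeriod (fun y => F^[(n : ℕ)] y - k) ((1 / 8 + t / 4) / m) = minimalPeriod g t := by
  have hm0 : (m : ℝ) ≠ 0 := by positivity
  refine minimalPeriod_conj (φ := fun t : ℝ => (1 / 8 + t / 4) / m) hmaps (fun x y h => ?_)
    (fun x hx => rotBump_first_return hkn hc hmr hm hid hmaps heq hx) ht
  simp only [div_left_inj' hm0] at h
  linarith

include hkn hc hmr hm hid hmaps hF hge heq in
theorem lowerEnd_of_rotBump {P : Set ℕ+} (hgP : periodSet g = P) (h1P : 1 ∈ P) :
    LowerEnd F c P := by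
  have hm0 : (m : ℝ) ≠ 0 := by positivity
  have hn0 : ((n : ℕ) : ℝ) ≠ 0 := by positivity
  refine ⟨?_, fun x ρ h => h.ge_of_le
    fun i => rotBump_iterate_ge hc hmr hm hid hmaps hge x i, ?_, ?_⟩
  · have h0 : (0 : ℝ) ∈ Icc (0 : ℝ) 1 := by simp
    have h1 := rotBump_first_return hkn hc hmr hm hid hmaps heq h0
    rw [hid 0 (Or.inl le_rfl), sub_eq_iff_eq_add] at h1
    exact ⟨_, hc ▸ hF.rotNum_of_returns n.pos h1⟩
  · intro x N hN hx
    rw [hc] at hx ⊢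
    rw [mem_Lam_iff hkn]
    obtain ⟨q, rfl, hq⟩ := hF.minimalPeriod_of_isPer hkn hN hx
    refine ⟨q, ?_, rfl⟩
    -- If each step advances by at least `c`, then `F^n - k` is nondecreasing along the orbit, which
    -- forces `q = 1`. Otherwise some step falls short of `c`; since `F` lies above `rotBump`, this
    -- happens only on the arc carrying `g`.
    by_cases hcase : ∀ i, F^[i] x + c ≤ F (F^[i] x)
    · have h2 : ∀ i j : ℕ, F^[j] x + i * c ≤ F^[i + j] x := by
        intro i j
        induction i with
        | zero => simp
        | succ i ih =>
          have := hcase (i + j)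
          rw [← iterate_succ_apply' F] at this
          rw [show i + 1 + j = (i + j).succ by omega]
          push_cast
          linarith
      have h3 : q = 1 := eq_one_of_le_succ hq fun e => by
        have e1 := hF.iterate_mul n k e x
        have e2 : (fun y => F^[(n : ℕ)] y - k)^[e] x = F^[(n : ℕ) * e] x + (-(k * e) : ℤ) := by
          rw [e1]; push_cast; ring
        have e3 := h2 n (n * e)
        have e4 : (n : ℕ) * c = k := by rw [hc]; field_simp
        rw [e2]
        simp only [hF.iterate_add_int]
        rw [← iterate_add_apply]
        linarith
      rw [h3]
      exact h1P
    · push Not at hcase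
      obtain ⟨i, hi⟩ := hcase
      have hs : ¬ (4 * m * Int.fract (F^[i] x) - 1 / 2 ≤ 0 ∨
          1 ≤ 4 * m * Int.fract (F^[i] x) - 1 / 2) := fun hs =>
        absurd (add_le_of_not_mem hid hge hs) (not_le.2 hi)
      push Not at hs
      set y := F^[i] x
      have hy := hF.isPer_add_int (hF.isPer_iterate hN i) (-⌊y⌋)
      have hy' := (hF.rotNum_iterate hN hx i).add_int hF (-⌊y⌋)
      obtain ⟨q', hq', hper⟩ := hF.minimalPeriod_of_isPer hkn hy hy'
      obtain rfl := mul_left_cancel hq'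
      have e : y + (-⌊y⌋ : ℤ) = (1 / 8 + (4 * m * Int.fract y - 1 / 2) / 4) / m := by
        rw [Int.fract]; push_cast; field_simp; ring
      have hs' : 4 * m * Int.fract y - 1 / 2 ∈ Icc (0 : ℝ) 1 := ⟨hs.1.le, hs.2.le⟩
      rw [e, rotBump_minimalPeriod hkn hc hmr hm hid hmaps heq hs'] at hper
      rw [← hgP]
      exact ⟨_, hs', hper⟩
  · intro N hN
    rw [hc, mem_Lam_iff hkn] at hN
    obtain ⟨q, hq, rfl⟩ := hN
    rw [← hgP] at hq
    obtain ⟨t, ht, htq⟩ := hq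
    exact ⟨_, hF.isPer_of_minimalPeriod hkn
      ((rotBump_minimalPeriod hkn hc hmr hm hid hmaps heq ht).trans htq)⟩

end rational

end SigmaMaps

namespace SigmaMaps

open Filter Topology Set Function

/-! ## Irrational end points -/

theorem lowerEnd_of_irrational {F : ℝ → ℝ} (hF : IsLift F) {c : ℝ} (hc : Irrational c)
    (h0 : ∃ x, RotNum F x c) (hle : ∀ x ρ, RotNum F x ρ → c ≤ ρ) (P : Set ℕ+) :
    LowerEnd F c P := by
  refine ⟨h0, hle, fun x N hN hx => ?_, ?_⟩
  · obtain ⟨K, hK⟩ := hN.1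
    refine absurd (tendsto_nhds_unique hx (hF.rotNum_of_returns N.pos hK)) fun h => ?_
    exact hc ⟨(K : ℚ) / N, by rw [h]; push_cast; rfl⟩
  · rintro N ⟨k, n, -, h, -⟩
    exact absurd ⟨(k : ℚ) / n, by rw [h]; push_cast; rfl⟩ hc

/-- A monotone lifting increasing only on `[1/8, 3/8]` modulo one. -/
noncomputable def stair (y : ℝ) : ℝ := y + (clamp (4 * Int.fract y - 1 / 2) - Int.fract y)

theorem stair_eq (y : ℝ) : stair y = ⌊y⌋ + clamp (4 * Int.fract y - 1 / 2) := by
  rw [stair]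
  linarith [Int.floor_add_fract y]

theorem stair_continuous : Continuous stair := by
  refine continuous_id.add (ContinuousOn.comp_fract'' (f := fun t : ℝ =>
    clamp (4 * t - 1 / 2) - t) (by fun_prop) ?_)
  rw [clamp_of_nonpos (by norm_num), clamp_of_one_le (by norm_num)]
  norm_num

theorem stair_add_int (y : ℝ) (k : ℤ) : stair (y + k) = stair y + k := by
  simp only [stair, Int.fract_add_intCast]
  ring

theorem stair_monotone : Monotone stair := by
  intro x y hxy
  rw [stair_eq, stair_eq]
  have h1 := clamp_mem (4 * Int.fract x - 1 / 2)
  have h2 := clamp_mem (4 * Int.fract y - 1 / 2)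
  rcases (Int.floor_mono hxy).eq_or_lt with h | h
  · have h3 : Int.fract x ≤ Int.fract y := by rw [Int.fract, Int.fract, h]; linarith
    rw [h]
    have : clamp (4 * Int.fract x - 1 / 2) ≤ clamp (4 * Int.fract y - 1 / 2) :=
      max_le_max le_rfl (min_le_min le_rfl (by linarith))
    linarith
  · have h3 : (⌊x⌋ : ℝ) + 1 ≤ ⌊y⌋ := by exact_mod_cast h
    linarith [h1.2, h2.1]

theorem abs_stair_sub_le (y : ℝ) : |stair y - y| ≤ 1 := by
  have h1 := clamp_mem (4 * Int.fract y - 1 / 2)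
  rw [stair, add_sub_cancel_left, abs_le]
  constructor <;> linarith [h1.1, h1.2, Int.fract_nonneg y, Int.fract_lt_one y]

/-- The family of liftings `x ↦ τ + stair (m x) / m`. -/
noncomputable def stairLift (m : ℕ) (τ : ℝ) (x : ℝ) : ℝ := τ + stair (m * x) / m

section stairLift

variable {m : ℕ} (hm : 0 < m)
include hm

theorem stairLift_isLift (τ : ℝ) : IsLift (stairLift m τ) := by
  have hm0 : (m : ℝ) ≠ 0 := by positivity
  constructor
  · have := stair_continuous
    unfold stairLift
    fun_prop
  · intro x
    have := stair_add_int (m * x) m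
    rw [Int.cast_natCast] at this
    rw [stairLift, mul_add, mul_one, this, stairLift]
    field_simp
    ring

theorem stairLift_monotone (τ : ℝ) : Monotone (stairLift m τ) := fun x y h => by
  have hm' : (0 : ℝ) < m := by exact_mod_cast hm
  have := stair_monotone (mul_le_mul_of_nonneg_left h hm'.le)
  unfold stairLift
  gcongr

/-- `stairLift` as a bundled monotone lifting. -/
noncomputable def stairCircle (τ : ℝ) : CircleDeg1Lift :=
  ⟨⟨stairLift m τ, stairLift_monotone hm τ⟩, (stairLift_isLift hm τ).map_add_one⟩

theorem stairLift_bounds (τ x : ℝ) :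
    x + (τ - 1 / m) ≤ stairLift m τ x ∧ stairLift m τ x ≤ x + (τ + 1 / m) := by
  have hm' : (0 : ℝ) < m := by exact_mod_cast hm
  have h := abs_le.1 (abs_stair_sub_le (m * x))
  have e : stairLift m τ x = x + τ + (stair (m * x) - m * x) / m := by
    rw [stairLift]; field_simp; ring
  have h1 : -(1 / (m : ℝ)) ≤ (stair (m * x) - m * x) / m := by
    rw [← neg_div]; exact div_le_div_of_nonneg_right h.1 hm'.le
  have h2 : (stair (m * x) - m * x) / m ≤ 1 / (m : ℝ) := div_le_div_of_nonneg_right h.2 hm'.le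
  rw [e]
  constructor <;> linarith

omit hm in
theorem stairLift_iterate_continuous (m q : ℕ) : Continuous fun τ => (stairLift m τ)^[q] 0 := by
  induction q with
  | zero => exact continuous_const
  | succ q ih =>
    simp only [iterate_succ_apply']
    unfold stairLift at ih ⊢
    have := stair_continuous
    fun_prop

/-- A strict comparison of the translation number with a rational `p / q` forces a strict comparison
of the `q`-th iterate of `0` with `p`. The latter is open in `τ` and gives back a weak comparison.
-/
theorem translationNumber_stairCircle_continuous :
    Continuous fun τ => (stairCircle hm τ).translationNumber := by
  have hpow : ∀ (τ : ℝ) (q : ℕ), (stairCircle hm τ ^ q) 0 = (stairLift m τ)^[q] 0 := fun τ q => by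
    rw [CircleDeg1Lift.coe_pow]; rfl
  rw [continuous_iff_continuousAt]
  intro τ
  refine tendsto_order.2 ⟨fun a ha => ?_, fun a ha => ?_⟩
  · obtain ⟨r, h1, h2⟩ := exists_rat_btwn ha
    have hq : (0 : ℝ) < r.den := by exact_mod_cast r.den_pos
    have e : (r : ℝ) * r.den = r.num := by exact_mod_cast r.mul_den_eq_num
    have h3 : (r.num : ℝ) < (stairCircle hm τ ^ r.den).translationNumber := by
      rw [CircleDeg1Lift.translationNumber_pow, ← e]
      nlinarith
    have h4 := CircleDeg1Lift.lt_map_of_int_lt_translationNumber _ h3 0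
    rw [hpow] at h4
    filter_upwards [(stairLift_iterate_continuous m r.den).continuousAt.eventually
      (lt_mem_nhds h4)] with σ hσ
    rw [← hpow] at hσ
    have h5 := CircleDeg1Lift.le_translationNumber_of_add_int_le _ hσ.le
    rw [CircleDeg1Lift.translationNumber_pow, ← e] at h5
    refine h1.trans_le (le_of_mul_le_mul_left ?_ hq)
    linarith
  · obtain ⟨r, h1, h2⟩ := exists_rat_btwn ha
    have hq : (0 : ℝ) < r.den := by exact_mod_cast r.den_pos
    have e : (r : ℝ) * r.den = r.num := by exact_mod_cast r.mul_den_eq_num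
    have h3 : (stairCircle hm τ ^ r.den).translationNumber < (r.num : ℝ) := by
      rw [CircleDeg1Lift.translationNumber_pow, ← e]
      nlinarith
    have h4 := CircleDeg1Lift.map_lt_of_translationNumber_lt_int _ h3 0
    rw [hpow] at h4
    filter_upwards [(stairLift_iterate_continuous m r.den).continuousAt.eventually
      (gt_mem_nhds h4)] with σ hσ
    rw [← hpow] at hσ
    have h5 := CircleDeg1Lift.translationNumber_le_of_le_add_int _ hσ.le
    rw [CircleDeg1Lift.translationNumber_pow, ← e] at h5
    refine lt_of_le_of_lt (le_of_mul_le_mul_left ?_ hq) h2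
    linarith

theorem exists_stairCircle (c : ℝ) :
    ∃ τ, (stairCircle hm τ).translationNumber = c ∧ ∀ x, |stairLift m τ x - x - c| ≤ 2 / m := by
  have hb : ∀ τ, τ - 1 / m ≤ (stairCircle hm τ).translationNumber ∧
      (stairCircle hm τ).translationNumber ≤ τ + 1 / m := fun τ =>
    ⟨CircleDeg1Lift.le_translationNumber_of_add_le _ fun x => (stairLift_bounds hm τ x).1,
      CircleDeg1Lift.translationNumber_le_of_le_add _ fun x => (stairLift_bounds hm τ x).2⟩
  obtain ⟨τ, hτ⟩ := mem_range_of_exists_le_of_exists_ge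
    (translationNumber_stairCircle_continuous hm) (c := c)
    ⟨c - 1 / m, by linarith [(hb (c - 1 / m)).2]⟩ ⟨c + 1 / m, by linarith [(hb (c + 1 / m)).1]⟩
  refine ⟨τ, hτ, fun x => ?_⟩
  have h1 := hb τ
  have h2 := stairLift_bounds hm τ x
  have h3 : (2 : ℝ) / m = 1 / m + 1 / m := by ring
  simp only at hτ
  rw [hτ] at h1
  rw [abs_le, h3]
  constructor <;> linarith [h1.1, h1.2, h2.1, h2.2]

theorem stairLift_surjOn_arcs (τ y : ℝ) : ∃ x ∈ arcs m, stairLift m τ x = y := by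
  have hm0 : (m : ℝ) ≠ 0 := by positivity
  set v := m * (y - τ) with hv
  have h0 := Int.fract_nonneg v
  have h1 := Int.fract_lt_one v
  have e : m * ((⌊v⌋ + (1 / 8 + Int.fract v / 4)) / m) = (1 / 8 + Int.fract v / 4) + ⌊v⌋ := by
    field_simp; ring
  have e2 : Int.fract (1 / 8 + Int.fract v / 4 + ⌊v⌋) = 1 / 8 + Int.fract v / 4 := by
    rw [Int.fract_add_intCast, Int.fract_eq_self]
    constructor <;> linarith
  refine ⟨(⌊v⌋ + (1 / 8 + Int.fract v / 4)) / m, ?_, ?_⟩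
  · change Int.fract ((m : ℝ) * _) ∈ Icc (1 / 8 : ℝ) (3 / 8)
    rw [e, e2]
    constructor <;> linarith
  · have e3 : stair (1 / 8 + Int.fract v / 4 + ⌊v⌋) = v := by
      rw [stair, e2, clamp_of_mem ⟨by linarith, by linarith⟩]
      linarith [Int.floor_add_fract v]
    rw [stairLift, e, e3, hv]
    field_simp
    ring

/-- Outside the arcs `stairLift` is locally constant, so the arcs alone already map onto `ℝ`.
Preimages chosen in the arcs give orbits that stay there for any finite time, and compactness gives
an infinite one. -/
theorem exists_orbit_in_arcs (τ : ℝ) : ∃ x, ∀ i, (stairLift m τ)^[i] x ∈ arcs m := by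
  have hL := stairLift_isLift hm τ
  have hfin : ∀ n : ℕ, ∃ x, ∀ i ≤ n, (stairLift m τ)^[i] x ∈ arcs m := by
    intro n
    induction n with
    | zero =>
      obtain ⟨x, hx, -⟩ := stairLift_surjOn_arcs hm τ 0
      exact ⟨x, fun i hi => by obtain rfl : i = 0 := by omega
                               exact hx⟩
    | succ n ih =>
      obtain ⟨y, hy⟩ := ih
      obtain ⟨x, hx, hxy⟩ := stairLift_surjOn_arcs hm τ y
      refine ⟨x, fun i hi => ?_⟩
      rcases i with _ | i
      · exact hx
      · rw [iterate_succ_apply, hxy]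
        exact hy i (by omega)
  -- The initial point is confined to `[0, 1]` by an integer translation, as the arcs themselves are
  -- not compact.
  obtain ⟨x, hx⟩ := exists_itinerary hL.cont (fun i => if i = 0 then arcs m ∩ Icc 0 1 else arcs m)
    (fun i => by split_ifs; exacts [(isClosed_arcs m).inter isClosed_Icc, isClosed_arcs m])
    (by simpa using isCompact_Icc.inter_left (isClosed_arcs m)) fun n => by
      obtain ⟨x, hx⟩ := hfin n
      have h1 : ∀ i ≤ n, (stairLift m τ)^[i] (x + (-⌊x⌋ : ℤ)) ∈ arcs m := fun i hi => by
        rw [hL.iterate_add_int]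
        exact add_int_mem_arcs (hx i hi) _
      have h2 : x + (-⌊x⌋ : ℤ) = Int.fract x := by rw [Int.fract]; push_cast; ring
      refine ⟨x + (-⌊x⌋ : ℤ), fun i hi => ?_⟩
      split_ifs with h
      · refine ⟨h1 i hi, ?_⟩
        rw [h, iterate_zero, id, h2]
        exact ⟨Int.fract_nonneg _, (Int.fract_lt_one _).le⟩
      · exact h1 i hi
  refine ⟨x, fun i => ?_⟩
  have := hx i
  split_ifs at this
  exacts [this.1, this]

/-- The orbit inside the arcs is also an orbit of `F`, so `c` is attained. Monotonicity of
`stairLift` keeps every orbit of `F` above the corresponding one of `stairLift`, so nothing smaller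
occurs. -/
theorem lowerEnd_of_stairLift {c τ : ℝ} (hc : Irrational c)
    (hτ : (stairCircle hm τ).translationNumber = c) {F : ℝ → ℝ} (hF : IsLift F)
    (hge : ∀ x, stairLift m τ x ≤ F x) (heq : ∀ x ∈ arcs m, F x = stairLift m τ x) (P : Set ℕ+) :
    LowerEnd F c P := by
  have hrot : ∀ x, RotNum (stairLift m τ) x c := fun x => by
    have := (stairCircle hm τ).tendsto_translationNumber x
    rw [hτ] at this
    refine this.congr fun n => ?_
    rw [CircleDeg1Lift.coe_pow]
    rfl
  refine lowerEnd_of_irrational hF hc ?_ (fun x ρ hx => ?_) P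
  · obtain ⟨x, hx⟩ := exists_orbit_in_arcs hm τ
    refine ⟨x, (hrot x).congr fun n => ?_⟩
    congr 2
    induction n with
    | zero => rfl
    | succ n ih => rw [iterate_succ_apply', iterate_succ_apply' F, ← ih, heq _ (hx n)]
  · refine le_of_tendsto_of_tendsto' (hrot x) hx fun n => ?_
    have : (stairLift m τ)^[n] x ≤ F^[n] x := by
      induction n with
      | zero => exact le_rfl
      | succ n ih =>
        rw [iterate_succ_apply', iterate_succ_apply' F]
        exact (stairLift_monotone hm τ ih).trans (hge _)
    gcongr

end stairLift

/-! ## Gluing the two ends -/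

theorem exists_coprime_of_not_irrational {c : ℝ} (hc : ¬ Irrational c) :
    ∃ (k : ℤ) (n : ℕ+), IsCoprime k (n : ℤ) ∧ c = (k : ℝ) / n := by
  rw [Irrational, not_not] at hc
  obtain ⟨r, rfl⟩ := hc
  refine ⟨r.num, ⟨r.den, r.den_pos⟩, ?_, Rat.cast_def r⟩
  rw [Int.isCoprime_iff_gcd_eq_one]
  exact r.reduced

/-- Every `c` is the lower end of the rotation interval of all liftings that lie above a suitable
lifting `L` and agree with it on the arcs. -/
theorem exists_lower (c : ℝ) (P : Set ℕ+) (h1 : 1 ∈ P) (hP : ∀ k ∈ P, Sh (.num k) ⊆ P) {m : ℕ}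
    (hm : 0 < m)
    (hcm : ∀ (k : ℤ) (n : ℕ+), IsCoprime k (n : ℤ) → c = (k : ℝ) / n → (n : ℕ) ∣ m) :
    ∃ L, IsLift L ∧ (∀ x, |L x - x - c| ≤ 2 / m) ∧ ∀ F, IsLift F → (∀ x, L x ≤ F x) →
      (∀ x ∈ arcs m, F x = L x) → LowerEnd F c P := by
  have hm' : (0 : ℝ) < m := by exact_mod_cast hm
  by_cases hc : Irrational c
  · obtain ⟨τ, hτ, hb⟩ := exists_stairCircle hm c
    exact ⟨_, stairLift_isLift hm τ, hb, fun F hF hge heq =>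
      lowerEnd_of_stairLift hm hc hτ hF hge heq P⟩
  · obtain ⟨k, n, hkn, hc⟩ := exists_coprime_of_not_irrational hc
    obtain ⟨r, hr⟩ := hcm k n hkn hc
    obtain ⟨g, hg, hid, hmaps, hgP⟩ := exists_map_of_periodSet P h1 hP
    refine ⟨_, rotBump_isLift (c := c) hg hid hm, fun x => ?_, fun F hF hge heq =>
      lowerEnd_of_rotBump hkn hc hr hm hid hmaps hF hge heq hgP h1⟩
    refine (abs_rotBump_sub_le hid hmaps hm x).trans ?_
    gcongr
    norm_num

theorem Lam_neg (c : ℝ) (P : Set ℕ+) : Lam (-c) P = Lam c P := by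
  have key : ∀ c : ℝ, Lam c P ⊆ Lam (-c) P := by
    rintro c N ⟨k, n, hkn, rfl, h⟩
    exact ⟨-k, n, hkn.neg_left, by push_cast; ring, h⟩
  exact Subset.antisymm (by simpa using key (-c)) (key c)

/-- Realization of an interval of rotation numbers and a set of periods by a lifting of a circle
map. -/
theorem exists_lift_of_ends {f : ℝ → ℝ} {c d : ℝ} {P Q : Set ℕ+} (hf : IsLift f)
    (hl : LowerEnd f c P) (hu : LowerEnd (reflect f) (-d) Q) :
    (∀ ρ, (∃ x, RotNum f x ρ) ↔ ρ ∈ Icc c d) ∧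
      ∀ n, (∃ x, IsPer f x n) ↔ n ∈ Lam c P ∪ M c d ∪ Lam d Q := by
  have hle : ∀ x ρ, RotNum f x ρ → ρ ≤ d := fun x ρ h => by
    have := hu.le _ _ h.reflect
    linarith
  obtain ⟨x₀, h0⟩ := hl.exists_rotNum
  obtain ⟨x₁, h1⟩ := hu.exists_rotNum
  rw [rotNum_reflect_iff, neg_neg] at h1
  refine ⟨fun ρ => ⟨fun ⟨x, hx⟩ => ⟨hl.le x ρ hx, hle x ρ hx⟩, fun ⟨h2, h3⟩ => ?_⟩, fun n =>
    ⟨fun ⟨x, hx⟩ => ?_, ?_⟩⟩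
  · rcases h2.eq_or_lt with rfl | h2
    · exact ⟨x₀, h0⟩
    · rcases h3.eq_or_lt with rfl | h3
      · exact ⟨_, h1⟩
      · exact hf.exists_rotNum h0 h1 h2 h3
  · obtain ⟨K, hK⟩ := hx.1
    have hρ := hf.rotNum_of_returns n.pos hK
    rcases (hl.le _ _ hρ).eq_or_lt with h2 | h2
    · exact Or.inl (Or.inl (hl.mem_of_isPer x n hx (h2 ▸ hρ)))
    · rcases (hle _ _ hρ).eq_or_lt with h3 | h3
      · right
        rw [← Lam_neg]
        refine hu.mem_of_isPer (-x) n ?_ ?_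
        · rwa [isPer_reflect_iff, neg_neg]
        · rw [← h3]; exact hρ.reflect
      · exact Or.inl (Or.inr ⟨K, h2, h3⟩)
  · rintro ((h | h) | h)
    · exact hl.exists_isPer n h
    · exact hf.exists_isPer_of_mem_M h0 h1 h
    · rw [← Lam_neg] at h
      obtain ⟨x, hx⟩ := hu.exists_isPer n h
      exact ⟨_, isPer_reflect_iff.1 hx⟩

theorem exists_denominator (c : ℝ) : ∃ m : ℕ, 0 < m ∧
    ∀ (k : ℤ) (n : ℕ+), IsCoprime k (n : ℤ) → c = (k : ℝ) / n → (n : ℕ) ∣ m := by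
  by_cases h : ∃ (k : ℤ) (n : ℕ+), IsCoprime k (n : ℤ) ∧ c = (k : ℝ) / n
  · obtain ⟨k, n, -, hc⟩ := h
    refine ⟨n, n.pos, fun k' n' hk' hc' => ?_⟩
    obtain ⟨q, -, hq, -⟩ := dvd_of_ratio n'.pos hk' n.pos (hc.symm.trans hc')
    exact Dvd.intro _ hq.symm
  · push Not at h
    exact ⟨1, one_pos, fun k n hkn hc => absurd hc (h k n hkn)⟩

theorem exists_lift_of_lt {c d : ℝ} (hcd : c < d) {P Q : Set ℕ+} (hP1 : 1 ∈ P)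
    (hP : ∀ k ∈ P, Sh (.num k) ⊆ P) (hQ1 : 1 ∈ Q) (hQ : ∀ k ∈ Q, Sh (.num k) ⊆ Q) :
    ∃ f, IsLift f ∧ LowerEnd f c P ∧ LowerEnd (reflect f) (-d) Q := by
  obtain ⟨m₁, hm₁, h1⟩ := exists_denominator c
  obtain ⟨m₂, hm₂, h2⟩ := exists_denominator (-d)
  obtain ⟨e, he⟩ := exists_nat_gt (4 / (d - c))
  have he0 : 0 < e := by
    have : (0 : ℝ) < e := lt_trans (div_pos four_pos (by linarith)) he
    exact_mod_cast this
  -- The factors `m₁` and `m₂` make `m` a multiple of the denominators of rational ends; `e` makes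
  -- `4 / m ≤ d - c`, so that the errors `2 / m` of `L` and `R` still allow `L ≤ reflect R`.
  set m := m₁ * m₂ * e
  have hm : 0 < m := by positivity
  have hm' : (0 : ℝ) < m := by exact_mod_cast hm
  have hem : (e : ℝ) ≤ m := by
    exact_mod_cast Nat.le_mul_of_pos_left e (Nat.mul_pos hm₁ hm₂)
  have h4 : 2 / (m : ℝ) + 2 / m ≤ d - c := by
    rw [div_lt_iff₀ (by linarith)] at he
    rw [← add_div, div_le_iff₀ hm']
    nlinarith
  obtain ⟨L, hL, hLb, hLF⟩ := exists_lower c P hP1 hP hm fun k n hkn hc =>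
    (h1 k n hkn hc).trans ⟨m₂ * e, by ring⟩
  obtain ⟨R, hR, hRb, hRF⟩ := exists_lower (-d) Q hQ1 hQ hm fun k n hkn hc =>
    (h2 k n hkn hc).trans ⟨m₁ * e, by ring⟩
  have hLR : ∀ x, L x ≤ reflect R x := fun x => by
    have b1 := abs_le.1 (hLb x)
    have b2 := abs_le.1 (hRb (-x))
    simp only [reflect]
    linarith [b1.2, b2.2]
  set u : ℝ → ℝ := fun x => clamp (profile (Int.fract (m * x))) with hu
  have huc : Continuous u :=
    continuous_clamp.comp (profile_fract_continuous.comp (continuous_const_mul _))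
  have hu01 : ∀ x, u x ∈ Icc (0 : ℝ) 1 := fun x => clamp_mem _
  have hup : ∀ x, u (x + 1) = u x := fun x => by
    simp only [hu, mul_add, mul_one, Int.fract_add_natCast]
  -- The weight `u` is `0` on the arcs and `1` on their mirror images, so this convex combination
  -- agrees with `L` on the former and with `reflect R` on the latter.
  have hf : IsLift fun x => L x + u x * (reflect R x - L x) := by
    refine ⟨hL.cont.add (huc.mul (hR.reflect.cont.sub hL.cont)), fun x => ?_⟩
    simp only [hup, hL.map_add_one, hR.reflect.map_add_one]
    ring
  refine ⟨_, hf, hLF _ hf (fun x => ?_) fun x hx => ?_,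
    hRF _ hf.reflect (fun x => ?_) fun x hx => ?_⟩
  · nlinarith [hLR x, (hu01 x).1]
  · have : u x = 0 := clamp_of_nonpos ((profile_nonpos_iff (Int.fract_lt_one _)).2 hx)
    simp only [this]
    ring
  · have := hLR (-x)
    simp only [reflect] at this ⊢
    rw [neg_neg] at this ⊢
    nlinarith [(hu01 (-x)).2]
  · have h5 : u (-x) = 1 := by
      have h6 : Int.fract (m * -x) = 1 - Int.fract (m * x) := by
        rw [Int.fract_eq_iff]
        have hx1 : (1 / 8 : ℝ) ≤ Int.fract (m * x) := hx.1
        refine ⟨by linarith [Int.fract_lt_one (m * x)], by linarith, -⌊m * x⌋ - 1, ?_⟩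
        rw [Int.fract]
        push_cast
        ring
      simp only [hu, h6]
      refine clamp_of_one_le ?_
      have hx1 : (1 / 8 : ℝ) ≤ Int.fract (m * x) := hx.1
      have hx2 : Int.fract (m * x) ≤ (3 / 8 : ℝ) := hx.2
      rw [profile]
      refine le_min (le_max_of_le_right ?_) ?_ <;> linarith
    simp only [reflect] at h5 ⊢
    rw [h5, neg_neg]
    ring

theorem LowerEnd.reflect {f : ℝ → ℝ} {c : ℝ} {P : Set ℕ+} (h : LowerEnd f c P)
    (hle : ∀ x ρ, RotNum f x ρ → ρ ≤ c) : LowerEnd (reflect f) (-c) P := by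
  obtain ⟨x, hx⟩ := h.exists_rotNum
  refine ⟨⟨-x, hx.reflect⟩, fun x ρ hx => ?_, fun x n hn hx => ?_, fun n hn => ?_⟩
  · linarith [hle _ _ (rotNum_reflect_iff.1 hx)]
  · rw [Lam_neg]
    rw [rotNum_reflect_iff, neg_neg] at hx
    exact h.mem_of_isPer _ _ (isPer_reflect_iff.1 hn) hx
  · rw [Lam_neg] at hn
    obtain ⟨x, hx⟩ := h.exists_isPer n hn
    exact ⟨-x, isPer_reflect_iff.2 (by rwa [neg_neg])⟩

/-- Here no interpolation is needed: an irrational translation, or `rotBump` itself, drifts at rate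
`c` up to a bounded error in both directions, so `c` is both ends. -/
theorem exists_lift_self (c : ℝ) {P : Set ℕ+} (hP1 : 1 ∈ P) (hP : ∀ k ∈ P, Sh (.num k) ⊆ P) :
    ∃ f, IsLift f ∧ LowerEnd f c P ∧ LowerEnd (reflect f) (-c) P := by
  by_cases hc : Irrational c
  · have hf : IsLift fun x => x + c := ⟨by fun_prop, fun x => by ring⟩
    have hit : ∀ (i : ℕ) (x : ℝ), (fun x => x + c)^[i] x = x + i * c := fun i x => by
      induction i with
      | zero => simp
      | succ i ih => rw [iterate_succ_apply', ih]; push_cast; ring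
    have hrot : ∀ x, RotNum (fun x => x + c) x c := fun x =>
      RotNum.of_bounded (C := 0) fun i => by rw [hit]; simp
    have hun : ∀ x ρ, RotNum (fun x => x + c) x ρ → ρ = c := fun x ρ h =>
      tendsto_nhds_unique h (hrot x)
    have hl := lowerEnd_of_irrational hf hc ⟨0, hrot 0⟩ (fun x ρ h => (hun x ρ h).ge) P
    exact ⟨_, hf, hl, hl.reflect fun x ρ h => (hun x ρ h).le⟩
  · obtain ⟨k, n, hkn, hc⟩ := exists_coprime_of_not_irrational hc
    obtain ⟨g, hg, hid, hmaps, hgP⟩ := exists_map_of_periodSet P hP1 hP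
    have hf := rotBump_isLift (c := c) hg hid n.pos
    have hmr : (n : ℕ) = n * 1 := (mul_one _).symm
    have hl := lowerEnd_of_rotBump hkn hc hmr n.pos hid hmaps hf (fun _ => le_rfl)
      (fun _ _ => rfl) hgP hP1
    refine ⟨_, hf, hl, hl.reflect fun x ρ h => ?_⟩
    have h1 := h.reflect.ge_of_le (σ := -c) (C := 2 / (n : ℕ)) fun i => by
      have := rotBump_iterate_le hc hmr n.pos hid hmaps x i
      rw [reflect_iterate, neg_neg]
      linarith
    linarith

/-! ## Maps of the covering space -/

/-- The map of `S` collapsing the branches onto their base points and then applying `f`. -/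
def collapseMap (f : ℝ → ℝ) (z : Cover) : Cover := ⟨(f (z : ℂ).re : ℂ), Or.inl (Complex.ofReal_im _)⟩

theorem collapseMap_iterate_re (f : ℝ → ℝ) (n : ℕ) (z : Cover) :
    ((collapseMap f)^[n] z : ℂ).re = f^[n] (z : ℂ).re := by
  induction n with
  | zero => rfl
  | succ n ih => rw [iterate_succ_apply', iterate_succ_apply', ← ih]; exact Complex.ofReal_re _

/-- The point of the real line in `S` with coordinate `x`. -/
def ofReal (x : ℝ) : Cover := ⟨(x : ℂ), Or.inl (Complex.ofReal_im x)⟩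

theorem hasRotationNumber_collapseMap_iff {f : ℝ → ℝ} {z : Cover} {ρ : ℝ} :
    HasRotationNumber (collapseMap f) z ρ ↔ RotNum f (z : ℂ).re ρ := by
  simp only [HasRotationNumber, RotNum, collapseMap_iterate_re]

theorem returnsModOne_collapseMap {f : ℝ → ℝ} {z : Cover} {n : ℕ}
    (h : ReturnsModOne (collapseMap f) z n) : Returns f (z : ℂ).re n := by
  obtain ⟨k, hk⟩ := h
  refine ⟨k, ?_⟩
  rw [← collapseMap_iterate_re, hk]
  simp [deck]

theorem returnsModOne_collapseMap_iff {f : ℝ → ℝ} {z : Cover} (hz : z ∈ realLine) {n : ℕ} :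
    ReturnsModOne (collapseMap f) z n ↔ Returns f (z : ℂ).re n := by
  refine ⟨returnsModOne_collapseMap, fun ⟨k, hk⟩ => ⟨k, Subtype.ext (Complex.ext ?_ ?_)⟩⟩
  · rw [collapseMap_iterate_re, hk]
    simp [deck]
  · have hz : (z : ℂ).im = 0 := hz
    have : ((collapseMap f)^[n] z : ℂ).im = 0 := by
      rcases n with _ | n
      · exact hz
      · rw [iterate_succ_apply']; exact Complex.ofReal_im _
    rw [this]
    simp [deck, hz]

/-- Images lie on the real line and integer translations preserve the imaginary part, so points off
the line never return and contribute no periods. -/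
theorem mem_realLine_of_returnsModOne {f : ℝ → ℝ} {z : Cover} {n : ℕ} (hn : 0 < n)
    (h : ReturnsModOne (collapseMap f) z n) : z ∈ realLine := by
  obtain ⟨k, hk⟩ := h
  obtain ⟨i, rfl⟩ := Nat.exists_eq_succ_of_ne_zero hn.ne'
  have h1 := congrArg (fun w : Cover => (w : ℂ).im) hk
  simp only [iterate_succ_apply', deck] at h1
  change (z : ℂ).im = 0
  simpa [collapseMap] using h1.symm

theorem mem_Per_collapseMap_iff {f : ℝ → ℝ} {n : ℕ+} :
    n ∈ Per (collapseMap f) ↔ ∃ x, IsPer f x n := by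
  constructor
  · rintro ⟨z, h1, h2⟩
    have hz := mem_realLine_of_returnsModOne n.pos h1
    simp only [returnsModOne_collapseMap_iff hz] at h1 h2
    exact ⟨_, h1, h2⟩
  · rintro ⟨x, hx⟩
    have hz : ofReal x ∈ realLine := Complex.ofReal_im x
    refine ⟨ofReal x, ?_⟩
    simp only [IsPeriodModOne, returnsModOne_collapseMap_iff hz]
    exact hx

theorem collapseMap_mem_Lift {f : ℝ → ℝ} (hf : IsLift f) : collapseMap f ∈ Lift 1 := by
  constructor
  · exact (Complex.continuous_ofReal.comp (hf.cont.comp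
      (Complex.continuous_re.comp continuous_subtype_val))).subtype_mk _
  · intro z
    apply Subtype.ext
    simp [collapseMap, deck, hf.map_add_one]

theorem collapseMap_image_branch (f : ℝ → ℝ) (m : ℤ) :
    collapseMap f '' branch m = {collapseMap f (basePoint m)} := by
  have hb : basePoint m ∈ branch m := by simp [basePoint, branch]
  refine Subset.antisymm ?_ (singleton_subset_iff.2 (mem_image_of_mem _ hb))
  rintro _ ⟨z, hz, rfl⟩
  have hz : (z : ℂ).re = m := hz
  have hb : (basePoint m : ℂ).re = m := hb
  exact Subtype.ext (by simp only [collapseMap, hz, hb])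

end SigmaMaps

/-! ### The theorem on `S` -/

theorem mainTheorem5 (c d : ℝ) (hcd : c ≤ d) (s_c s_d : SigmaMaps.NSh) :
    ∃ F ∈ SigmaMaps.Lift 1,
      SigmaMaps.RotReal F = Set.Icc c d ∧
      SigmaMaps.Rot F = Set.Icc c d ∧
      SigmaMaps.Per F =
        SigmaMaps.Lam c (SigmaMaps.Sh s_c) ∪ SigmaMaps.M c d ∪
          SigmaMaps.Lam d (SigmaMaps.Sh s_d) ∧
      Set.MapsTo F SigmaMaps.realLine SigmaMaps.realLine ∧
      ∀ m : ℤ, F '' SigmaMaps.branch m = {F (SigmaMaps.basePoint m)} := by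
  open SigmaMaps in
  obtain ⟨f, hf, hrot, hper⟩ : ∃ f, IsLift f ∧ (∀ ρ, (∃ x, RotNum f x ρ) ↔ ρ ∈ Set.Icc c d) ∧
      ∀ n, (∃ x, IsPer f x n) ↔ n ∈ Lam c (Sh s_c) ∪ M c d ∪ Lam d (Sh s_d) := by
    rcases hcd.eq_or_lt with rfl | hcd
    -- For `c = d` the set `M(c, c)` is empty and both `Λ` sit at the same rotation number, so one
    -- interval map has to carry the union of the two Sharkovsky segments.
    · obtain ⟨f, hf, hl, hu⟩ := exists_lift_self c (P := Sh s_c ∪ Sh s_d) (Or.inl (one_mem_Sh _))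
        (by
          rintro k (hk | hk)
          · exact (Sh_num_subset hk).trans Set.subset_union_left
          · exact (Sh_num_subset hk).trans Set.subset_union_right)
      obtain ⟨h1, h2⟩ := exists_lift_of_ends hf hl hu
      refine ⟨f, hf, h1, fun n => (h2 n).trans ?_⟩
      have hM : n ∉ M c c := fun ⟨k, h3, h4⟩ => lt_asymm h3 h4
      have hL : n ∈ Lam c (Sh s_c ∪ Sh s_d) ↔ n ∈ Lam c (Sh s_c) ∨ n ∈ Lam c (Sh s_d) := by
        constructor
        · rintro ⟨k, m, h3, h4, q, hq | hq, h5⟩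
          exacts [Or.inl ⟨k, m, h3, h4, q, hq, h5⟩, Or.inr ⟨k, m, h3, h4, q, hq, h5⟩]
        · rintro (⟨k, m, h3, h4, q, hq, h5⟩ | ⟨k, m, h3, h4, q, hq, h5⟩)
          exacts [⟨k, m, h3, h4, q, Or.inl hq, h5⟩, ⟨k, m, h3, h4, q, Or.inr hq, h5⟩]
      simp only [Set.mem_union]
      tauto
    · obtain ⟨f, hf, hl, hu⟩ := exists_lift_of_lt hcd (one_mem_Sh s_c) (fun _ => Sh_num_subset)
        (one_mem_Sh s_d) (fun _ => Sh_num_subset)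
      exact ⟨f, hf, exists_lift_of_ends hf hl hu⟩
  open SigmaMaps in
  refine ⟨collapseMap f, collapseMap_mem_Lift hf, ?_, ?_, ?_, fun z _ => Complex.ofReal_im _,
    collapseMap_image_branch f⟩
  · ext ρ
    rw [← hrot]
    constructor
    · rintro ⟨z, -, hz⟩
      exact ⟨_, hasRotationNumber_collapseMap_iff.1 hz⟩
    · rintro ⟨x, hx⟩
      exact ⟨ofReal x, Complex.ofReal_im x, hasRotationNumber_collapseMap_iff.2 hx⟩
  · ext ρ
    rw [← hrot]
    constructor
    · rintro ⟨z, hz⟩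
      exact ⟨_, hasRotationNumber_collapseMap_iff.1 hz⟩
    · rintro ⟨x, hx⟩
      exact ⟨ofReal x, hasRotationNumber_collapseMap_iff.2 hx⟩
  · ext n
    rw [mem_Per_collapseMap_iff, hper]
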